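/- **Model.** Agents $\mathcal N_a=\{1,\dots,N_a\}$ have unknown positions $\mathbf p_k\in\mathbb R^2$, stacked in $\mathbf P$; anchors $j\in\mathcal N_b$ have known positions $\mathbf p_j$. Put $d_{kj}=\|\mathbf p_k-\mathbf p_j\|$ and let $\phi_{kj}$ be the angle with $\mathbf q_{kj}:=[\cos\phi_{kj}\ \sin\phi_{kj}]^{T}=(\mathbf p_k-\mathbf p_j)/d_{kj}$; let $\mathbf R(\phi)=\begin{bmatrix}\cos^2\phi&\cos\phi\sin\phi\\ \cos\phi\sin\phi&\sin^2\phi\end{bmatrix}$. For every pair $(k,j)$ of a given set of links ($k$ an agent, $j\ne k$ any node), agent $k$ receives on $[0,T)$ the waveform $$r_{kj}(t)=\sum_{l=1}^{L_{kj}}\alpha^{(l)}_{kj}\,s\big(t-\tau^{(l)}_{kj}\big)+z_{kj}(t),\qquad \tau^{(l)}_{kj}=\tfrac1c\big(d_{kj}+b^{(l)}_{kj}\big),$$ where $s\in C^3$ is known and the $z_{kj}$ are independent white Gaussian noises of two-sided power spectral density $N_0/2$. The vector $\boldsymbol\kappa_{kj}$ consists of all biases $b^{(l)}_{kj}$ and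 amplitudes $\alpha^{(l)}_{kj}$, except that for a line-of-sight signal $b^{(1)}_{kj}=0$ is known and is left out. The likelihood of $r_{kj}$ is $$f(\mathbf r_{kj}|\boldsymbol\theta)\propto\exp\Big\{\tfrac2{N_0}\int_0^{T} r_{kj}\,m_{kj}\,dt-\tfrac1{N_0}\int_0^{T} m_{kj}^2\,dt\Big\},\qquad m_{kj}(t)=\sum_l\alpha_{kj}^{(l)}s(t-\tau_{kj}^{(l)}).$$ The channel parameters of different waveforms are independent given $\mathbf P$, so the parameter vector $\boldsymbol\theta=(\mathbf P,(\boldsymbol\kappa_{kj}))$ has the prior density $f(\mathbf P)\prod_{(k,j)}f(\boldsymbol\kappa_{kj}|d_{kj})$. The densities $f(\mathbf P)$ and $f(\boldsymbol\kappa_{kj}|d)$ are twice continuously differentiable on the open sets where they are positive, $\int f(\boldsymbol\kappa_{kj}|d)\,d\boldsymbol\kappa_{kj}$ may be differentiated once in $d$ under the integral sign (with an integrable dominating function), and $\mathbf P$ and the second derivatives of the terms of the log-density that occur below have finite expectations. Let $$\mathbf J_{\boldsymbol\theta}=\mathbb E_{\mathbf r,\boldsymbol\theta}\Big\{-\tfrac{\partial^2}{\partial\boldsymbol\theta\,\partial\boldsymbol\theta^T}\ln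 f(\mathbf r,\boldsymbol\theta)\Big\}=\begin{bmatrix}\mathbf A&\mathbf B\\ \mathbf B^T&\mathbf C\end{bmatrix}$$ be the Fisher information matrix, partitioned according to $\mathbf P$ and the channel parameters; the equivalent Fisher information matrix (EFIM) of the positions is $\mathbf J_e(\mathbf P)=\mathbf A-\mathbf B\mathbf C^{-1}\mathbf B^T$. Let $\boldsymbol\Xi_{\mathbf P}=\mathbb E_{\mathbf P}\{-\partial^2\ln f(\mathbf P)/\partial\mathbf P\,\partial\mathbf P^T\}$. For a link $(k,j)$, at given positions (expectations over $\mathbf r,\boldsymbol\kappa$ given $\mathbf P$, $\mathbf x,\mathbf y\in\{d_{kj},\boldsymbol\kappa_{kj}\}$), put $$\boldsymbol\Phi_{kj}(\mathbf x,\mathbf y)=\mathbb E\Big\{-\tfrac{\partial^2}{\partial\mathbf x\,\partial\mathbf y^T}\big[\ln f(\mathbf r_{kj}|d_{kj},\boldsymbol\kappa_{kj})+\ln f(\boldsymbol\kappa_{kj}|d_{kj})\big]\Big\},\quad \boldsymbol\Xi_{kj}(\mathbf x,\mathbf y)=\mathbb E\Big\{-\tfrac{\partial^2\ln f(\boldsymbol\kappa_{kj}|d_{kj})}{\partial\mathbf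 x\,\partial\mathbf y^T}\Big\},$$ let $\boldsymbol\Psi_{kj}$ be the expectation of minus the Hessian of $\ln f(\mathbf r_{kj}|\cdot)$ in the delays $\tau^{(l)}_{kj}$ and scaled amplitudes $\alpha^{(l)}_{kj}/c$, let $\mathbf l_{kj}$ be the vector with entry $1$ at the delays and $0$ at the amplitudes, and define the ranging information intensity (RII) $$\lambda_{kj}=\tfrac1{c^2}\Big[\mathbf l_{kj}^T\boldsymbol\Psi_{kj}\mathbf l_{kj}+c^2\Xi_{kj}(d_{kj},d_{kj})-\mathbf w_{kj}\big(\boldsymbol\Psi_{kj}+c^2\boldsymbol\Xi_{kj}(\boldsymbol\kappa_{kj},\boldsymbol\kappa_{kj})\big)^{-1}\mathbf w_{kj}^T\Big],\qquad \mathbf w_{kj}=\mathbf l_{kj}^T\boldsymbol\Psi_{kj}+c^2\boldsymbol\Xi_{kj}(d_{kj},\boldsymbol\kappa_{kj}),$$ where $\mathbf w_{kj}$ and the inverted matrix are restricted to the unknown coordinates (for a line-of-sight signal the coordinate of $b^{(1)}_{kj}$ is deleted); $\lambda_{kj}=0$ if $(k,j)$ is not a link. **Corollary.** Let $\bar{\mathbf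 P}=\mathbb E\{\mathbf P\}$ be such that $\bar{\mathbf p}_k\neq\bar{\mathbf p}_j$ for all links $(k,j)$ (with $\bar{\mathbf p}_j=\mathbf p_j$ for anchors) and the inverse matrices in $\bar\lambda_{kj}$ exist, where bars denote evaluation at $\bar{\mathbf P}$. Put $$\bar{\mathbf J}_A(\mathbf p_k)=\sum_{j\in\mathcal N_b}\bar\lambda_{kj}\mathbf R(\bar\phi_{kj}),\qquad \bar{\mathbf C}_{kj}=(\bar\lambda_{kj}+\bar\lambda_{jk})\mathbf R(\bar\phi_{kj}),$$ and let $\mathbf S$ be the $2N_a\times2N_a$ matrix with diagonal $2\times2$ blocks $\bar{\mathbf J}_A(\mathbf p_k)+\sum_{j\in\mathcal N_a\setminus\{k\}}\bar{\mathbf C}_{kj}$ and off-diagonal blocks $-\bar{\mathbf C}_{km}$. 1. If the prior satisfies $\mathbb E_{\mathbf P}\{g(\mathbf P)\}=g(\bar{\mathbf P})$ for all entries $g$ of $\Phi_{kj}(d_{kj},d_{kj})\,\mathbf q_{kj}\mathbf q_{kj}^T$, $\mathbf q_{kj}\boldsymbol\Phi_{kj}(d_{kj},\boldsymbol\kappa_{kj})$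 and $\boldsymbol\Phi_{kj}(\boldsymbol\kappa_{kj},\boldsymbol\kappa_{kj})$, for all links $(k,j)$, then $$\mathbf J_e(\mathbf P)=\mathbf S+\boldsymbol\Xi_{\mathbf P}.$$ 2. The same holds approximately: for every $\varepsilon>0$ there is $\delta>0$, depending only on the network, $\bar{\mathbf P}$ and $\varepsilon$, such that for every prior density of $\mathbf P$ with mean $\bar{\mathbf P}$ and $|\mathbb E_{\mathbf P}\{g(\mathbf P)\}-g(\bar{\mathbf P})|\le\delta$ for these $g$, every entry of $\mathbf J_e(\mathbf P)-(\mathbf S+\boldsymbol\Xi_{\mathbf P})$ is at most $\varepsilon$ in absolute value. 3. $\bar{\mathbf C}_{kj}=\bar{\mathbf C}_{jk}$; and $\bar\lambda_{kj}\ge0$ for every link at which the second derivatives of $f(\boldsymbol\kappa_{kj}|d)$ in $(d,\boldsymbol\kappa_{kj})$, at $d=\bar d_{kj}$, are integrable over its support with integral zero. -/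

import Mathlib

open MeasureTheory ProbabilityTheory
open scoped NNReal

noncomputable section

namespace CoopLoc

/-- A point of the plane. -/
abbrev Pt : Type := EuclideanSpace ℝ (Fin 2)

/-- The positions of all `Na` agents. -/
abbrev Positions (Na : ℕ) : Type := Fin Na → Pt

/-- Nodes of the network: agents (`inl`) and anchors (`inr`). -/
abbrev Node (Na Nb : ℕ) : Type := Fin Na ⊕ Fin Nb

/-- Matrix of second partial derivatives of `F` at `x` along the directions `v i`. -/
def hess {E ι : Type*} [NormedAddCommGroup E] [NormedSpace ℝ E] (v : ι → E) (F : E → ℝ) (x : E) :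
    Matrix ι ι ℝ :=
  Matrix.of fun i j => fderiv ℝ (fun y => fderiv ℝ F y (v j)) x (v i)

/-! ### Geometry -/

/-- The direction angle `φ`, with `cos φ = (x_p - x_q) / ‖p - q‖`, `sin φ = (y_p - y_q) / ‖p - q‖`,
so that `tan φ = (y_p - y_q) / (x_p - x_q)`. -/
def angle (p q : Pt) : ℝ := Complex.arg ⟨p 0 - q 0, p 1 - q 1⟩

/-- The unit vector with angle `φ`. -/
def unitVec (φ : ℝ) : Fin 2 → ℝ := ![Real.cos φ, Real.sin φ]

/-- The ranging direction matrix. -/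
def rdm (φ : ℝ) : Matrix (Fin 2) (Fin 2) ℝ :=
  !![Real.cos φ ^ 2, Real.cos φ * Real.sin φ; Real.cos φ * Real.sin φ, Real.sin φ ^ 2]

/-! ### Multipath parameters of one received waveform -/

/-- Among the coordinates of a channel with `L` paths, `inl l` is the range bias of path `l` and
`inr l` its amplitude. In line-of-sight the bias of the first path is known (to be `0`). -/
def knownBias {L : ℕ} (los : Bool) : Fin L ⊕ Fin L → Bool
  | .inl l => los && decide (l.val = 0)
  | .inr _ => false

/-- Index set of the unknown multipath parameters `κ` of a channel. -/
abbrev ChanCoord (L : ℕ) (los : Bool) : Type := {i : Fin L ⊕ Fin L // knownBias los i = false}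

/-- All biases and amplitudes of the channel; the known bias of a line-of-sight path is `0`. -/
def fullParam {L : ℕ} {los : Bool} (κ : ChanCoord L los → ℝ) (i : Fin L ⊕ Fin L) : ℝ :=
  if h : knownBias los i = false then κ ⟨i, h⟩ else 0

/-- Delays `τ_l = (d + b_l) / c` (`inl l`) and scaled amplitudes `α_l / c` (`inr l`). -/
def delayAmp {L : ℕ} {los : Bool} (c d : ℝ) (κ : ChanCoord L los → ℝ) : Fin L ⊕ Fin L → ℝ
  | .inl l => (d + fullParam κ (.inl l)) / c
  | .inr l => fullParam κ (.inr l) / c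

/-- The vector `l`: one on the delay coordinates, zero on the amplitude coordinates. -/
def lVec (L : ℕ) : Fin L ⊕ Fin L → ℝ := Sum.elim (fun _ => 1) (fun _ => 0)

/-- Noise-free received signal `∑ l, α_l s (t - τ_l)`, with `x` the delays and scaled amplitudes. -/
def rxSignal {L : ℕ} (c : ℝ) (s : ℝ → ℝ) (x : Fin L ⊕ Fin L → ℝ) (t : ℝ) : ℝ :=
  ∑ l, c * x (.inr l) * s (t - x (.inl l))

/-- `∫₀ᵀ r(t) m(t) dt`, where the waveform `r` is given through its primitive `R` with `R 0 = 0`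
(`r` contains white noise and is not a function; `R` is continuous). For smooth `m` this is the
Wiener integral `∫₀ᵀ m dR`, computed path by path through integration by parts. -/
def correlate (T : ℝ) (R m : ℝ → ℝ) : ℝ := m T * R T - ∫ t in (0 : ℝ)..T, R t * deriv m t

/-- Likelihood of one observed waveform (given through its primitive `R`), with respect to the
law of the noise, as a function of the delays and scaled amplitudes. -/
def lik {L : ℕ} (c N₀ T : ℝ) (s : ℝ → ℝ) (R : ℝ → ℝ) (x : Fin L ⊕ Fin L → ℝ) : ℝ :=
  Real.exp (2 / N₀ * correlate T R (rxSignal c s x) -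
    1 / N₀ * ∫ t in (0 : ℝ)..T, rxSignal c s x t ^ 2)

/-- Primitive of the observed waveform: primitive of the noise-free signal plus the primitive of
white noise of two-sided power spectral density `N₀ / 2`, that is `√(N₀ / 2)` times a Brownian
path `β`. -/
def observed {L : ℕ} (c N₀ : ℝ) (s : ℝ → ℝ) (x : Fin L ⊕ Fin L → ℝ) (β : ℝ≥0 → ℝ) (t : ℝ) : ℝ :=
  (∫ u in (0 : ℝ)..t, rxSignal c s x u) + Real.sqrt (N₀ / 2) * β t.toNNReal

/-! ### The network -/

/-- A network with `Na` agents and `Nb` anchors. A link `(k, j)` stands for a waveform received by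
agent `k` from node `j`; only values of `L`, `los`, `chan` on links are used. -/
structure Network (Na Nb : ℕ) where
  /-- positions of the anchors -/
  anchor : Fin Nb → Pt
  /-- the waveforms that are received -/
  links : Finset (Fin Na × Node Na Nb)
  no_self : ∀ k, (k, Sum.inl k) ∉ links
  /-- propagation speed -/
  c : ℝ
  c_pos : 0 < c
  /-- noise level: the two-sided power spectral density is `N₀ / 2` -/
  N₀ : ℝ
  N₀_pos : 0 < N₀
  /-- length of the observation interval -/
  T : ℝ
  T_pos : 0 < T
  /-- transmitted waveform -/
  s : ℝ → ℝ
  s_smooth : ContDiff ℝ 3 s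
  /-- number of multipath components -/
  L : Fin Na × Node Na Nb → ℕ
  /-- whether the direct path is unobstructed -/
  los : Fin Na × Node Na Nb → Bool
  /-- conditional density of the multipath parameters given the distance -/
  chan : ∀ e, (ChanCoord (L e) (los e) → ℝ) → ℝ → ℝ

namespace Network

variable {Na Nb : ℕ} (N : Network Na Nb)

/-- Unknown multipath parameters of the link `e`. -/
abbrev Coord (e : Fin Na × Node Na Nb) : Type := ChanCoord (N.L e) (N.los e)

/-- The parameter vector: positions of the agents and multipath parameters of all waveforms. -/
abbrev Param : Type := Positions Na × (∀ e : N.links, N.Coord e → ℝ)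

/-- Coordinates of the agents' positions. -/
abbrev PosIdx (Na : ℕ) : Type := Fin Na × Fin 2

/-- Coordinates of all multipath parameters. -/
abbrev ChanIdx : Type := Σ e : N.links, N.Coord e

def nodePos (P : Positions Na) : Node Na Nb → Pt := Sum.elim P N.anchor

/-- Distance between the two ends of a link. -/
def linkDist (e : Fin Na × Node Na Nb) (P : Positions Na) : ℝ := ‖P e.1 - N.nodePos P e.2‖

/-- The angle `φ_kj` of a pair `(k, j)`. -/
def linkAngle (e : Fin Na × Node Na Nb) (P : Positions Na) : ℝ := angle (P e.1) (N.nodePos P e.2)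

/-- Basis vector of a coordinate of the positions. -/
def posDir (i : PosIdx Na) : Positions Na := Pi.single i.1 (EuclideanSpace.single i.2 (1 : ℝ))

/-- Basis vector of a coordinate of the parameter vector. -/
def paramDir : PosIdx Na ⊕ N.ChanIdx → N.Param
  | .inl i => (posDir i, 0)
  | .inr i => (0, Pi.single i.1 (Pi.single i.2 1))

/-- Basis vector of a coordinate of the pair `(d, κ)`; `inl ()` is the coordinate `d`. -/
def linkDir (e : Fin Na × Node Na Nb) : Unit ⊕ N.Coord e → ℝ × (N.Coord e → ℝ)
  | .inl _ => (1, 0)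
  | .inr i => (0, Pi.single i 1)

/-- Likelihood of one waveform given the distance and the multipath parameters. -/
def linkLik (e : Fin Na × Node Na Nb) (R : ℝ → ℝ) (y : ℝ × (N.Coord e → ℝ)) : ℝ :=
  lik N.c N.N₀ N.T N.s R (delayAmp N.c y.1 y.2)

/-- The observation of one waveform at true values `y = (d, κ)` and Brownian path `β`. -/
def linkObs (e : Fin Na × Node Na Nb) (y : ℝ × (N.Coord e → ℝ)) (β : ℝ≥0 → ℝ) : ℝ → ℝ :=
  observed N.c N.N₀ N.s (delayAmp N.c y.1 y.2) β

/-- The pair `(d, κ)` of the link `e` in the parameter vector `θ`. -/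
def linkParam (e : N.links) (θ : N.Param) : ℝ × (N.Coord e → ℝ) := (N.linkDist e θ.1, θ.2 e)

/-- Conditional law of the multipath parameters given the distance. -/
def chanLaw (e : Fin Na × Node Na Nb) (d : ℝ) : Measure (N.Coord e → ℝ) :=
  volume.withDensity fun κ => ENNReal.ofReal (N.chan e κ d)

/-- Law of the agents' positions with density `f`. -/
def posLaw (f : Positions Na → ℝ) : Measure (Positions Na) :=
  volume.withDensity fun P => ENNReal.ofReal (f P)

/-- A priori density of the parameter vector: given the positions, the multipath parameters of
different waveforms are independent and depend on the positions through the distance. -/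
def priorDensity (f : Positions Na → ℝ) (θ : N.Param) : ℝ :=
  f θ.1 * ∏ e : N.links, N.chan e (θ.2 e) (N.linkDist e θ.1)

/-- A priori law of the parameter vector. -/
def priorLaw (f : Positions Na → ℝ) : Measure N.Param :=
  volume.withDensity fun θ => ENNReal.ofReal (N.priorDensity f θ)

/-- Joint density of the observed waveforms and the parameter vector. -/
def jointDensity (f : Positions Na → ℝ) (R : N.links → ℝ → ℝ) (θ : N.Param) : ℝ :=
  (∏ e : N.links, N.linkLik e (R e) (N.linkParam e θ)) * N.priorDensity f θ

section Noise

variable {Ω : Type*} [MeasurableSpace Ω] (B : N.links → ℝ≥0 → Ω → ℝ) (μ : Measure Ω)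

/-- The received waveforms contain independent white Gaussian noises. -/
structure IsNoise : Prop where
  meas : ∀ e t, Measurable (B e t)
  brownian : ∀ e, IsBrownianReal (B e) μ
  indep : iIndepFun (fun e ω t => B e t ω) μ

/-- All observed waveforms, at the true parameter `θ`. -/
def obs (θ : N.Param) (ω : Ω) (e : N.links) : ℝ → ℝ :=
  N.linkObs e (N.linkParam e θ) (B e · ω)

/-- The Fisher information matrix: expectation, over the parameter and the observations, of minus
the second derivatives of the logarithm of the joint density. -/
def fim (f : Positions Na → ℝ) : Matrix (PosIdx Na ⊕ N.ChanIdx) (PosIdx Na ⊕ N.ChanIdx) ℝ :=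
  Matrix.of fun i j => ∫ z : N.Param × Ω,
    -hess N.paramDir (fun θ => Real.log (N.jointDensity f (N.obs B z.1 z.2) θ)) z.1 i j
      ∂((N.priorLaw f).prod μ)

/-- The equivalent Fisher information matrix of the agents' positions (Schur complement). -/
def efim (f : Positions Na → ℝ) : Matrix (PosIdx Na) (PosIdx Na) ℝ :=
  let J := N.fim B μ f
  J.toBlocks₁₁ - J.toBlocks₁₂ * (J.toBlocks₂₂)⁻¹ * (J.toBlocks₁₂).transpose

/-- The a priori information `Ξ_P` of the agents' positions. -/
def posInfo (f : Positions Na → ℝ) : Matrix (PosIdx Na) (PosIdx Na) ℝ :=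
  Matrix.of fun i j => ∫ P, -hess posDir (fun Q => Real.log (f Q)) P i j ∂(posLaw f)

/-! ### Information of one waveform, given the distance -/

/-- The a priori channel information `Ξ(x, y)`, for `x, y` among `d` and the coordinates of `κ`. -/
def chanInfo (e : Fin Na × Node Na Nb) (d : ℝ) : Matrix (Unit ⊕ N.Coord e) (Unit ⊕ N.Coord e) ℝ :=
  Matrix.of fun i j => ∫ κ, -hess (N.linkDir e)
    (fun y : ℝ × (N.Coord e → ℝ) => Real.log (N.chan e y.2 y.1)) (d, κ) i j ∂(N.chanLaw e d)

/-- The information `Ψ` that the waveform carries about the delays and scaled amplitudes. -/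
def waveInfo (e : N.links) (d : ℝ) :
    Matrix (Fin (N.L e) ⊕ Fin (N.L e)) (Fin (N.L e) ⊕ Fin (N.L e)) ℝ :=
  Matrix.of fun i j => ∫ z : (N.Coord e → ℝ) × Ω,
    -hess (fun i => Pi.single i (1 : ℝ))
      (fun x => Real.log (lik N.c N.N₀ N.T N.s (N.linkObs e (d, z.1) (B e · z.2)) x))
      (delayAmp N.c d z.1) i j ∂((N.chanLaw e d).prod μ)

/-- The information `Φ(x, y)` of the waveform and the channel prior together, for `x, y` among `d`
and the coordinates of `κ`. -/
def linkInfo (e : N.links) (d : ℝ) : Matrix (Unit ⊕ N.Coord e) (Unit ⊕ N.Coord e) ℝ :=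
  Matrix.of fun i j => ∫ z : (N.Coord e → ℝ) × Ω,
    -hess (N.linkDir e)
      (fun y => Real.log (N.linkLik e (N.linkObs e (d, z.1) (B e · z.2)) y) +
        Real.log (N.chan e y.2 y.1)) (d, z.1) i j ∂((N.chanLaw e d).prod μ)

/-- The matrix `Ψ + c² Ξ(κ, κ)` on the unknown multipath parameters. -/
def nuisanceInfo (e : N.links) (d : ℝ) : Matrix (N.Coord e) (N.Coord e) ℝ :=
  (N.waveInfo B μ e d).submatrix Subtype.val Subtype.val +
    N.c ^ 2 • (N.chanInfo e d).toBlocks₂₂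

/-- The row vector `lᵀ Ψ + c² Ξ(d, κ)` on the unknown multipath parameters. -/
def crossInfo (e : N.links) (d : ℝ) : N.Coord e → ℝ :=
  fun i => Matrix.vecMul (lVec (N.L e)) (N.waveInfo B μ e d) i.val +
    N.c ^ 2 * N.chanInfo e d (.inl ()) (.inr i)

/-- The ranging information intensity of a received waveform, at distance `d`. -/
def linkRii (e : N.links) (d : ℝ) : ℝ :=
  1 / N.c ^ 2 * (dotProduct (lVec (N.L e)) (Matrix.mulVec (N.waveInfo B μ e d) (lVec (N.L e))) +
    N.c ^ 2 * N.chanInfo e d (.inl ()) (.inl ()) -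
    dotProduct (N.crossInfo B μ e d)
      (Matrix.mulVec (N.nuisanceInfo B μ e d)⁻¹ (N.crossInfo B μ e d)))

/-- The ranging information intensity `λ_kj` at positions `P`; zero if node `j` is not received by
agent `k`. -/
def rii (P : Positions Na) (k : Fin Na) (j : Node Na Nb) : ℝ :=
  if h : (k, j) ∈ N.links then N.linkRii B μ ⟨(k, j), h⟩ (N.linkDist (k, j) P) else 0

/-- Information of agent `k` from the anchors, at positions `P`. -/
def anchorInfo (P : Positions Na) (k : Fin Na) : Matrix (Fin 2) (Fin 2) ℝ :=
  ∑ j : Fin Nb, N.rii B μ P k (.inr j) • rdm (N.linkAngle (k, .inr j) P)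

/-- Information from the cooperation of the agents `k` and `j`, at positions `P`. -/
def coopInfo (P : Positions Na) (k j : Fin Na) : Matrix (Fin 2) (Fin 2) ℝ :=
  (N.rii B μ P k (.inl j) + N.rii B μ P j (.inl k)) • rdm (N.linkAngle (k, .inl j) P)

/-- The block matrix with blocks `J_A(k) + ∑ j ≠ k, C k j` on the diagonal and `-C k m` off the
diagonal, where `J_A` and `C` are evaluated at the positions `P`. -/
def structuredInfo (P : Positions Na) : Matrix (PosIdx Na) (PosIdx Na) ℝ :=
  Matrix.of fun x y =>
    if x.1 = y.1 then
      (N.anchorInfo B μ P x.1 + ∑ j ∈ Finset.univ.erase x.1, N.coopInfo B μ P x.1 j) x.2 y.2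
    else -N.coopInfo B μ P x.1 y.1 x.2 y.2

/-- The functions of the positions whose expectations occur in the equivalent Fisher information:
the entries of `Φ(d, d) q qᵀ`, `q Φ(d, κ)` and `Φ(κ, κ)`. -/
def relevantFun (e : N.links) :
    (Fin 2 × Fin 2) ⊕ (Fin 2 × N.Coord e) ⊕ (N.Coord e × N.Coord e) → Positions Na → ℝ
  | .inl (a, b), P => N.linkInfo B μ e (N.linkDist e P) (.inl ()) (.inl ()) *
      (unitVec (N.linkAngle e P) a * unitVec (N.linkAngle e P) b)
  | .inr (.inl (a, i)), P => unitVec (N.linkAngle e P) a *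
      N.linkInfo B μ e (N.linkDist e P) (.inl ()) (.inr i)
  | .inr (.inr (i, j)), P => N.linkInfo B μ e (N.linkDist e P) (.inr i) (.inr j)

end Noise

/-! ### Regularity -/

/-- `N.chan e` is a family of probability densities that is twice continuously differentiable where
it is positive, may be differentiated in `d` under the integral sign, and has finite Fisher
information. -/
structure IsChannelPrior (e : Fin Na × Node Na Nb) : Prop where
  nonneg : ∀ κ d, 0 ≤ N.chan e κ d
  meas : Measurable (Function.uncurry (N.chan e))
  prob : ∀ d, 0 < d → IsProbabilityMeasure (N.chanLaw e d)
  isOpen_pos : IsOpen {y : ℝ × (N.Coord e → ℝ) | 0 < y.1 ∧ 0 < N.chan e y.2 y.1}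
  smooth : ContDiffOn ℝ 2 (fun y : ℝ × (N.Coord e → ℝ) => N.chan e y.2 y.1)
    {y | 0 < y.1 ∧ 0 < N.chan e y.2 y.1}
  dominated : ∀ d₀, 0 < d₀ → ∃ ε > 0, ∃ bound : (N.Coord e → ℝ) → ℝ, Integrable bound ∧
    ∀ᵐ κ, ∀ d ∈ Metric.ball d₀ ε,
      DifferentiableAt ℝ (N.chan e κ) d ∧ |deriv (N.chan e κ) d| ≤ bound κ
  integrable : ∀ d, 0 < d → ∀ i j, Integrable (fun κ => hess (N.linkDir e)
    (fun y : ℝ × (N.Coord e → ℝ) => Real.log (N.chan e y.2 y.1)) (d, κ) i j) (N.chanLaw e d)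

/-- The second partial derivatives of the density `f(κ | d)` are integrable with integral zero over
its support (the condition under which the Fisher information is the covariance of the score). -/
def SecondOrderRegular (e : Fin Na × Node Na Nb) (d : ℝ) : Prop :=
  ∀ i j, IntegrableOn (fun κ => hess (N.linkDir e)
      (fun y : ℝ × (N.Coord e → ℝ) => N.chan e y.2 y.1) (d, κ) i j) {κ | 0 < N.chan e κ d} ∧
    ∫ κ in {κ | 0 < N.chan e κ d}, hess (N.linkDir e)
      (fun y : ℝ × (N.Coord e → ℝ) => N.chan e y.2 y.1) (d, κ) i j = 0

/-- The information `Ψ` of each waveform exists. -/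
def WaveInfoExists {Ω : Type*} [MeasurableSpace Ω] (B : N.links → ℝ≥0 → Ω → ℝ) (μ : Measure Ω) :
    Prop :=
  ∀ (e : N.links) (d : ℝ), 0 < d → ∀ i j, Integrable (fun z : (N.Coord e → ℝ) × Ω =>
    hess (fun i => Pi.single i (1 : ℝ))
      (fun x => Real.log (lik N.c N.N₀ N.T N.s (N.linkObs e (d, z.1) (B e · z.2)) x))
      (delayAmp N.c d z.1) i j) ((N.chanLaw e d).prod μ)

/-- `f` is an a priori density of the agents' positions with mean `Pbar`, and the expectations of
the second derivatives of the terms of the logarithm of the joint density exist. -/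
structure IsPositionPrior {Ω : Type*} [MeasurableSpace Ω] (B : N.links → ℝ≥0 → Ω → ℝ)
    (μ : Measure Ω) (Pbar : Positions Na) (f : Positions Na → ℝ) : Prop where
  nonneg : ∀ P, 0 ≤ f P
  prob : IsProbabilityMeasure (posLaw f)
  isOpen_pos : IsOpen {P | 0 < f P}
  smooth : ContDiffOn ℝ 2 f {P | 0 < f P}
  integrable_id : Integrable (fun P => P) (posLaw f)
  mean : ∫ P, P ∂(posLaw f) = Pbar
  integrable_pos : ∀ i j, Integrable (fun P => hess posDir (fun Q => Real.log (f Q)) P i j)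
    (posLaw f)
  integrable_chan : ∀ (e : N.links) (i j), Integrable (fun θ => hess N.paramDir
    (fun θ' => Real.log (N.chan e (θ'.2 e) (N.linkDist e θ'.1))) θ i j) (N.priorLaw f)
  integrable_wave : ∀ (e : N.links) (i j), Integrable (fun z : N.Param × Ω => hess N.paramDir
    (fun θ' => Real.log (N.linkLik e (N.obs B z.1 z.2 e) (N.linkParam e θ'))) z.1 i j)
    ((N.priorLaw f).prod μ)

end Network

end CoopLoc

end

/-! The logarithm of the joint density is `ln f(P)` plus one term `G_e(d_e(P), κ_e)` per link, where
`G_e` is the log-likelihood of the waveform plus the log channel prior. By the second-order chain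
rule (`hess_comp_linkParam`) the Hessian of such a term has two parts: the Hessian of `G_e` in `(d,
κ)`, weighted by the rates `±q` in positions and `1` in the link's own channel parameters, and the
second derivative of the distance times the score `∂G_e/∂d`.

Given the positions, the second part has mean zero. At the true parameter the signal part of the
log-likelihood is stationary, so its gradient is a Wiener integral (`IsNoise.score`); the prior
score is centred because `∫ f(κ|d) dκ = 1` can be differentiated under the integral
(`IsChannelPrior.score`). Fubini (`integral_priorLaw_prod`, `integral_linkHess`) then turns every
entry of the Fisher matrix into signed expectations over `P` of the relevant functions `g`, plus
`Ξ_P` in the position block (`fim_apply`). Hence the EFIM is `schur (E g) + Ξ_P` with a fixed map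
`schur` of finitely many real numbers (`efim_eq_schur`).

At `g(Pbar)` the channel block is block diagonal, so the Schur complement splits over links into
scalar Schur complements of `Φ`. The linear change from `(d, κ)` to delays and scaled amplitudes
identifies these scalars with the RII (`linkRii_eq`), and `q qᵀ = R(φ)`. Summing with the incidence
signs gives a graph Laplacian with matrix weights, which is `S` (`sum_incidence`,
`structuredInfo_apply`).

The exact claim is substitution of `E g = g(Pbar)`. The approximate one is continuity of `schur` at
an invertible channel block; `Ξ_P` cancels, so `δ` does not depend on the prior. The RII is
nonnegative as a Schur complement of a positive semidefinite matrix: the waveform part is a Gram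
matrix of signal derivatives, the prior part the covariance of the score (`linkRii_nonneg`). -/

noncomputable section

namespace CoopLoc

/-! ### Second directional derivatives -/

section SecondDeriv

variable {E F : Type*} [NormedAddCommGroup E] [NormedSpace ℝ E] [NormedAddCommGroup F]
  [NormedSpace ℝ F]

/-- Second derivative of `f` at `x` along `v` and `w`. -/
def d2 (f : E → F) (x v w : E) : F := fderiv ℝ (fun y => fderiv ℝ f y w) x v

theorem hess_eq_d2 {ι : Type*} (v : ι → E) (f : E → ℝ) (x : E) (i j : ι) :
    hess v f x i j = d2 f x (v i) (v j) := rfl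

theorem d2_congr {f g : E → F} {x : E} (h : f =ᶠ[nhds x] g) (v w : E) :
    d2 f x v w = d2 g x v w := by
  have h1 : (fun y => fderiv ℝ f y w) =ᶠ[nhds x] fun y => fderiv ℝ g y w := by
    filter_upwards [h.fderiv (𝕜 := ℝ)] with y hy
    rw [hy]
  rw [d2, d2, h1.fderiv_eq]

theorem differentiableAt_fderiv {f : E → F} {x : E} (hf : ContDiffAt ℝ 2 f x) :
    DifferentiableAt ℝ (fderiv ℝ f) x :=
  (hf.fderiv_right (m := 1) (by norm_num)).differentiableAt (by norm_num)

/-- Differentiability of `fderiv ℝ f` lets evaluation at `w` pass through the outer derivative.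
Bilinearity and symmetry of `d2` come from here. -/
theorem d2_eq {f : E → F} {x : E} (hf : ContDiffAt ℝ 2 f x) (v w : E) :
    d2 f x v w = fderiv ℝ (fderiv ℝ f) x v w := by
  have h := (differentiableAt_fderiv hf).hasFDerivAt.clm_apply (hasFDerivAt_const w x)
  rw [d2, h.fderiv]
  simp

theorem d2_add {f g : E → F} {x : E} (hf : ContDiffAt ℝ 2 f x) (hg : ContDiffAt ℝ 2 g x)
    (v w : E) : d2 (fun y => f y + g y) x v w = d2 f x v w + d2 g x v w := by
  have h : fderiv ℝ (fun y => f y + g y) =ᶠ[nhds x] fun y => fderiv ℝ f y + fderiv ℝ g y := by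
    filter_upwards [hf.eventually (by simp), hg.eventually (by simp)] with y h1 h2
    exact fderiv_fun_add (h1.differentiableAt (by norm_num)) (h2.differentiableAt (by norm_num))
  rw [d2_eq (hf.add hg), d2_eq hf, d2_eq hg, h.fderiv_eq,
    fderiv_fun_add (differentiableAt_fderiv hf) (differentiableAt_fderiv hg)]
  rfl

theorem d2_sum {ι : Type*} (s : Finset ι) {f : ι → E → F} {x : E}
    (hf : ∀ i ∈ s, ContDiffAt ℝ 2 (f i) x) (v w : E) :
    d2 (fun y => ∑ i ∈ s, f i y) x v w = ∑ i ∈ s, d2 (f i) x v w := by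
  classical
  induction s using Finset.induction_on with
  | empty => simp [d2]
  | insert a s ha ih =>
    simp only [Finset.sum_insert ha]
    rw [d2_add (hf a (Finset.mem_insert_self a s))
      (ContDiffAt.sum fun i hi => hf i (Finset.mem_insert_of_mem hi)),
      ih fun i hi => hf i (Finset.mem_insert_of_mem hi)]

theorem d2_const_mul {f : E → ℝ} {x : E} (hf : ContDiffAt ℝ 2 f x) (a : ℝ) (v w : E) :
    d2 (fun y => a * f y) x v w = a * d2 f x v w := by
  have h : (fun y => fderiv ℝ (fun y => a * f y) y w) =ᶠ[nhds x] fun y => a * fderiv ℝ f y w := by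
    filter_upwards [hf.eventually (by simp)] with y hy
    rw [fderiv_const_mul (hy.differentiableAt (by norm_num))]
    rfl
  rw [d2, h.fderiv_eq, fderiv_const_mul
    ((differentiableAt_fderiv hf).clm_apply (differentiableAt_const w))]
  rfl

theorem d2_smul_smul {f : E → F} {x : E} (hf : ContDiffAt ℝ 2 f x) (a b : ℝ) (v w : E) :
    d2 f x (a • v) (b • w) = (a * b) • d2 f x v w := by
  simp [d2_eq hf, smul_smul, mul_comm]

theorem d2_sum_sum {ι : Type*} [Fintype ι] {f : E → ℝ} {x : E} (hf : ContDiffAt ℝ 2 f x)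
    (a b : ι → ℝ) (e : ι → E) :
    d2 f x (∑ i, a i • e i) (∑ j, b j • e j) = ∑ i, ∑ j, a i * b j * d2 f x (e i) (e j) := by
  simp only [d2_eq hf, map_sum, map_smul, _root_.sum_apply,
    _root_.smul_apply, smul_eq_mul, Finset.mul_sum]
  rw [Finset.sum_comm]
  refine Finset.sum_congr rfl fun i _ => Finset.sum_congr rfl fun j _ => by ring

/-- The product rule applied to `fderiv g (y z) (fderiv y z w)`. The last term, gradient of `g`
times curvature of `y`, is the one that vanishes for linear `y`, at stationary points of `g`, or on
average for a score. -/
theorem d2_comp {G : Type*} [NormedAddCommGroup G] [NormedSpace ℝ G] {g : F → G} {y : E → F} {x : E}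
    (hg : ContDiffAt ℝ 2 g (y x)) (hy : ContDiffAt ℝ 2 y x) (v w : E) :
    d2 (fun z => g (y z)) x v w =
      d2 g (y x) (fderiv ℝ y x v) (fderiv ℝ y x w) + fderiv ℝ g (y x) (d2 y x v w) := by
  have hy1 : DifferentiableAt ℝ y x := hy.differentiableAt (by norm_num)
  have h : (fun z => fderiv ℝ (fun z => g (y z)) z w) =ᶠ[nhds x]
      fun z => fderiv ℝ g (y z) (fderiv ℝ y z w) := by
    filter_upwards [hy.eventually (by simp),
      hy.continuousAt.eventually (hg.eventually (by simp))] with z h1 h2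
    rw [fderiv_fun_comp z (h2.differentiableAt (by norm_num)) (h1.differentiableAt (by norm_num))]
    rfl
  have h1 : HasFDerivAt (fun z => fderiv ℝ g (y z))
      ((fderiv ℝ (fderiv ℝ g) (y x)).comp (fderiv ℝ y x)) x :=
    (differentiableAt_fderiv hg).hasFDerivAt.comp x hy1.hasFDerivAt
  have h2 : HasFDerivAt (fun z => fderiv ℝ y z w) (fderiv ℝ (fun z => fderiv ℝ y z w) x) x :=
    ((differentiableAt_fderiv hy).clm_apply (differentiableAt_const w)).hasFDerivAt
  rw [d2, h.fderiv_eq, (h1.clm_apply h2).fderiv, d2_eq hg]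
  simp [d2, add_comm]

/-- Under the density `f` the first term integrates to that of `f''`, and the second is a product of
scores; this makes the prior information a covariance. -/
theorem d2_log_comp {f : E → ℝ} {x : E} (hf : ContDiffAt ℝ 2 f x) (h0 : f x ≠ 0) (v w : E) :
    d2 (fun y => Real.log (f y)) x v w =
      d2 f x v w / f x - fderiv ℝ f x v * fderiv ℝ f x w / f x ^ 2 := by
  have hl : d2 Real.log (f x) (fderiv ℝ f x v) (fderiv ℝ f x w) =
      -(fderiv ℝ f x v * fderiv ℝ f x w / f x ^ 2) := by
    have h1 : (fun u : ℝ => fderiv ℝ Real.log u (fderiv ℝ f x w)) =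
        fun u => u⁻¹ * fderiv ℝ f x w := by
      funext u
      rw [← toSpanSingleton_deriv]
      simp [mul_comm]
    have h2 : HasDerivAt (fun u : ℝ => u⁻¹ * fderiv ℝ f x w)
      (-(f x ^ 2)⁻¹ * fderiv ℝ f x w) (f x) := (hasDerivAt_inv h0).mul_const _
    rw [d2, h1, h2.hasFDerivAt.fderiv]
    simp
    field_simp
  have hl' : fderiv ℝ Real.log (f x) (d2 f x v w) = d2 f x v w / f x := by
    rw [← toSpanSingleton_deriv]
    simp [div_eq_mul_inv]
  rw [d2_comp (Real.contDiffAt_log.2 h0) hf, hl, hl']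
  ring

end SecondDeriv

/-! ### Integrals that depend smoothly on a parameter -/

section Parametric

variable {E : Type*} [NormedAddCommGroup E] [NormedSpace ℝ E]

theorem fderiv_slice {H : E → ℝ → ℝ} (hH : ContDiff ℝ 1 (Function.uncurry H)) (x v : E) (t : ℝ) :
    fderiv ℝ (fun y => H y t) x v = fderiv ℝ (Function.uncurry H) (x, t) (v, 0) := by
  have h := ((hH.differentiable (by norm_num)) (x, t)).hasFDerivAt.comp x
    (hasFDerivAt_prodMk_left (𝕜 := ℝ) x t)
  have h' : HasFDerivAt (fun y => H y t)
    ((fderiv ℝ (Function.uncurry H) (x, t)).comp (ContinuousLinearMap.inl ℝ E ℝ)) x := h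
  rw [h'.fderiv]
  simp

theorem contDiff_slice_fderiv {H : E → ℝ → ℝ} {n : ℕ}
    (hH : ContDiff ℝ (n + 1 : ℕ) (Function.uncurry H)) (v : E) :
    ContDiff ℝ n (Function.uncurry fun x t => fderiv ℝ (fun y => H y t) x v) := by
  have h1 : ContDiff ℝ 1 (Function.uncurry H) := hH.of_le (by norm_cast; omega)
  have : (Function.uncurry fun x t => fderiv ℝ (fun y => H y t) x v) =
      fun p => fderiv ℝ (Function.uncurry H) p (v, 0) := by
    funext ⟨x, t⟩
    exact fderiv_slice h1 x v t
  rw [this]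
  exact (hH.fderiv_right (m := n) (by norm_cast)).clm_apply contDiff_const

variable [FiniteDimensional ℝ E]

theorem continuous_slice_fderiv {H : E → ℝ → ℝ} (hH : ContDiff ℝ 1 (Function.uncurry H)) :
    Continuous (Function.uncurry fun x t => fderiv ℝ (fun y => H y t) x) := by
  rw [continuous_clm_apply]
  intro v
  exact (contDiff_slice_fderiv (n := 0) (by simpa using hH) v).continuous

/-- The weight `φ` is only continuous because it will be a Brownian path; all smoothness in the
parameter sits in `H`. -/
theorem hasFDerivAt_integral_param (T : ℝ) {φ : ℝ → ℝ} (hφ : Continuous φ) {H : E → ℝ → ℝ}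
    (hH : ContDiff ℝ 1 (Function.uncurry H)) (x : E) :
    HasFDerivAt (fun x => ∫ t in (0 : ℝ)..T, φ t * H x t)
      (∫ t in (0 : ℝ)..T, φ t • fderiv ℝ (fun y => H y t) x) x := by
  have : ProperSpace E := FiniteDimensional.proper ℝ E
  have hc := continuous_slice_fderiv hH
  have hc' : Continuous (fun p : E × ℝ => φ p.2 • fderiv ℝ (fun y => H y p.2) p.1) :=
    (hφ.comp continuous_snd).smul hc
  -- Finite dimension makes the ball compact, so a constant dominates the derivative on ball times
  -- interval.
  obtain ⟨C, hC⟩ := ((isCompact_closedBall x 1).prod (isCompact_uIcc (a := 0) (b := T))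
    ).exists_bound_of_continuousOn hc'.continuousOn
  have hcx : ∀ y, Continuous fun t => φ t * H y t := fun y =>
    hφ.mul (hH.continuous.comp (Continuous.prodMk_right y))
  refine intervalIntegral.hasFDerivAt_integral_of_dominated_of_fderiv_le
    (s := Metric.closedBall x 1) (bound := fun _ => C)
    (F' := fun x t => φ t • fderiv ℝ (fun y => H y t) x)
    (Metric.closedBall_mem_nhds x one_pos)
    (Filter.Eventually.of_forall fun y => (hcx y).aestronglyMeasurable)
    ((hcx x).intervalIntegrable _ _)
    (hc'.comp (Continuous.prodMk_right x)).aestronglyMeasurable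
    (Filter.Eventually.of_forall fun t ht y hy => hC (y, t) ⟨hy, Set.uIoc_subset_uIcc ht⟩)
    intervalIntegrable_const
    (Filter.Eventually.of_forall fun t _ y _ => ?_)
  have hd : DifferentiableAt ℝ (fun y => H y t) y :=
    ((hH.comp (contDiff_id.prodMk contDiff_const)).differentiable (by norm_num)) y
  exact hd.hasFDerivAt.const_mul (φ t)

theorem fderiv_integral_param (T : ℝ) {φ : ℝ → ℝ} (hφ : Continuous φ) {H : E → ℝ → ℝ}
    (hH : ContDiff ℝ 1 (Function.uncurry H)) (x v : E) :
    fderiv ℝ (fun x => ∫ t in (0 : ℝ)..T, φ t * H x t) x v =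
      ∫ t in (0 : ℝ)..T, φ t * fderiv ℝ (fun y => H y t) x v := by
  have hc : Continuous fun t => φ t • fderiv ℝ (fun y => H y t) x :=
    hφ.smul ((continuous_slice_fderiv hH).comp (Continuous.prodMk_right x))
  rw [(hasFDerivAt_integral_param T hφ hH x).fderiv,
    ContinuousLinearMap.intervalIntegral_apply (hc.intervalIntegrable _ _)]
  rfl

/-- Each directional derivative is an integral of the same form with the same weight, which closes
the induction on `n`. -/
theorem contDiff_integral_param (T : ℝ) {φ : ℝ → ℝ} (hφ : Continuous φ) (n : ℕ) {H : E → ℝ → ℝ}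
    (hH : ContDiff ℝ n (Function.uncurry H)) :
    ContDiff ℝ n (fun x => ∫ t in (0 : ℝ)..T, φ t * H x t) := by
  induction n generalizing H with
  | zero =>
    have hc : Continuous (Function.uncurry fun x t => φ t * H x t) :=
      (hφ.comp continuous_snd).mul hH.continuous
    simpa using intervalIntegral.continuous_parametric_intervalIntegral_of_continuous' hc 0 T
  | succ n ih =>
    have h1 : ContDiff ℝ 1 (Function.uncurry H) := hH.of_le (by norm_cast; omega)
    have key : ContDiff ℝ ((n : WithTop ℕ∞) + 1) (fun x => ∫ t in (0 : ℝ)..T, φ t * H x t) := by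
      rw [contDiff_succ_iff_fderiv]
      refine ⟨fun x => (hasFDerivAt_integral_param T hφ h1 x).differentiableAt, by simp, ?_⟩
      rw [contDiff_clm_apply_iff]
      intro v
      simp only [fderiv_integral_param T hφ h1]
      exact ih (contDiff_slice_fderiv hH v)
    exact_mod_cast key

theorem d2_integral_param (T : ℝ) {φ : ℝ → ℝ} (hφ : Continuous φ) {H : E → ℝ → ℝ}
    (hH : ContDiff ℝ 2 (Function.uncurry H)) (x v w : E) :
    d2 (fun x => ∫ t in (0 : ℝ)..T, φ t * H x t) x v w =
      ∫ t in (0 : ℝ)..T, φ t * d2 (fun y => H y t) x v w := by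
  have h1 : ContDiff ℝ 1 (Function.uncurry H) := hH.of_le (by norm_num)
  have h : (fun y => fderiv ℝ (fun x => ∫ t in (0 : ℝ)..T, φ t * H x t) y w) =
      fun y => ∫ t in (0 : ℝ)..T, φ t * fderiv ℝ (fun z => H z t) y w := by
    funext y
    exact fderiv_integral_param T hφ h1 y w
  have hw : ContDiff ℝ 1 (Function.uncurry fun x t => fderiv ℝ (fun y => H y t) x w) := by
    exact_mod_cast contDiff_slice_fderiv (n := 1) (by exact_mod_cast hH) w
  rw [d2, h, fderiv_integral_param T hφ hw]
  rfl

end Parametric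

/-! ### Integrals of deterministic functions against a Brownian path -/

section Noise

variable {Ω : Type*} [MeasurableSpace Ω] {μ : Measure Ω}
  {β : ℝ≥0 → Ω → ℝ}

/-- Paths are continuous only almost surely. Setting them to zero on a measurable null set makes
every path continuous, hence the process jointly measurable, as Fubini requires. -/
theorem exists_continuous_modification (hm : ∀ t, Measurable (β t)) (hβ : IsBrownianReal β μ) :
    ∃ γ : ℝ≥0 → Ω → ℝ, (∀ t, Measurable (γ t)) ∧ (∀ ω, Continuous (γ · ω)) ∧
      ∀ᵐ ω ∂μ, ∀ t, γ t ω = β t ω := by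
  obtain ⟨s, hs, hsm, hs0⟩ := exists_measurable_superset_of_null hβ.cont
  classical
  refine ⟨fun t ω => if ω ∈ s then 0 else β t ω,
    fun t => Measurable.ite hsm measurable_const (hm t), fun ω => ?_, ?_⟩
  · by_cases h : ω ∈ s
    · simpa [h] using continuous_const
    · simp only [h, if_false]
      by_contra hc
      exact h (hs hc)
  · have : ∀ᵐ ω ∂μ, ω ∉ s := measure_eq_zero_iff_ae_notMem.1 hs0
    filter_upwards [this] with ω h t
    simp [h]

/-- From `|x| ≤ 1 + x²` and variance `t`. The bound is crude, but continuous in `t`, which suffices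
for integrability on a bounded interval. -/
theorem integral_abs_brownian_le [IsProbabilityMeasure μ] (hβ : IsBrownianReal β μ) (t : ℝ≥0) :
    ∫ ω, |β t ω| ∂μ ≤ 1 + t := by
  have hL := hβ.hasLaw_eval t
  have h2 : MemLp (β t) 2 μ := by
    have := (hβ.isGaussianProcess.hasGaussianLaw_eval t).memLp_two
    exact this
  have hv : ∫ ω, β t ω ^ 2 ∂μ = t := by
    have h := variance_of_integral_eq_zero (hβ.aemeasurable t) (hβ.integral_eval t)
    rw [hL.variance_eq] at h
    simpa using h.symm
  calc ∫ ω, |β t ω| ∂μ ≤ ∫ ω, (1 + β t ω ^ 2) ∂μ := by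
        refine integral_mono_of_nonneg (Filter.Eventually.of_forall fun _ => abs_nonneg _)
          ((integrable_const 1).add h2.integrable_sq) (Filter.Eventually.of_forall fun ω => ?_)
        show |β t ω| ≤ 1 + β t ω ^ 2
        nlinarith [sq_nonneg (|β t ω| - 1), sq_abs (β t ω), abs_nonneg (β t ω)]
    _ = 1 + t := by
        rw [integral_add (integrable_const 1) h2.integrable_sq, hv]
        simp

/-- This is the form taken by a Wiener integral after integration by parts. It is centred because
each `β t` is, once expectation and time integral are exchanged. -/
theorem integrable_brownian_pairing [IsProbabilityMeasure μ] (hm : ∀ t, Measurable (β t)) (hβ : IsBrownianReal β μ)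
    (T a : ℝ) {h : ℝ → ℝ} (hh : Continuous h) :
    Integrable (fun ω => a * β T.toNNReal ω - ∫ t in (0 : ℝ)..T, β t.toNNReal ω * h t) μ ∧
      ∫ ω, (a * β T.toNNReal ω - ∫ t in (0 : ℝ)..T, β t.toNNReal ω * h t) ∂μ = 0 := by
  obtain ⟨γ, hγm, hγc, hγ⟩ := exists_continuous_modification hm hβ
  have hjm : Measurable (Function.uncurry γ) :=
    measurable_uncurry_of_continuous_of_measurable hγc hγm
  have hae : ∀ t, γ t =ᵐ[μ] β t := fun t => hγ.mono fun ω h => h t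
  have hγi : ∀ t, Integrable (γ t) μ := fun t => (hβ.integrable_eval t).congr (hae t).symm
  have hγ0 : ∀ t, ∫ ω, γ t ω ∂μ = 0 := fun t => by
    rw [integral_congr_ae (hae t)]; exact hβ.integral_eval t
  set ν : Measure ℝ := volume.restrict (Set.uIoc 0 T) with hν
  have hjm' : Measurable (fun p : ℝ × Ω => γ p.1.toNNReal p.2 * h p.1) :=
    (hjm.comp ((measurable_real_toNNReal.comp measurable_fst).prodMk measurable_snd)).mul
      (hh.measurable.comp measurable_fst)
  have hprod : Integrable (fun p : ℝ × Ω => γ p.1.toNNReal p.2 * h p.1) (ν.prod μ) := by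
    rw [integrable_prod_iff hjm'.aestronglyMeasurable]
    refine ⟨Filter.Eventually.of_forall fun t => (hγi t.toNNReal).mul_const (h t), ?_⟩
    have hb : Integrable (fun t : ℝ => (1 + (t.toNNReal : ℝ)) * |h t|) ν := by
      have hc : Continuous fun t : ℝ => (1 + (t.toNNReal : ℝ)) * |h t| := by fun_prop
      exact intervalIntegrable_iff.1 (hc.intervalIntegrable 0 T)
    refine hb.mono' ?_ (Filter.Eventually.of_forall fun t => ?_)
    · exact (hjm'.norm.stronglyMeasurable.integral_prod_right (ν := μ)).aestronglyMeasurable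
    · rw [Real.norm_of_nonneg (integral_nonneg fun _ => norm_nonneg _)]
      simp only [norm_mul, Real.norm_eq_abs, integral_mul_const]
      refine mul_le_mul_of_nonneg_right ?_ (abs_nonneg _)
      calc ∫ ω, |γ t.toNNReal ω| ∂μ = ∫ ω, |β t.toNNReal ω| ∂μ :=
            integral_congr_ae ((hae t.toNNReal).mono fun ω hω => by simp only [hω])
        _ ≤ _ := integral_abs_brownian_le hβ _
  -- No sign of `T` is assumed, so the orientation of the interval integral survives as a factor
  -- `±1`.
  have hI : ∀ ω, ∫ t in (0 : ℝ)..T, γ t.toNNReal ω * h t =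
      (if 0 ≤ T then 1 else -1) * ∫ t, γ t.toNNReal ω * h t ∂ν := fun ω => by
    rw [intervalIntegral.intervalIntegral_eq_integral_uIoc]; simp [hν]
  have hint : Integrable (fun ω => ∫ t in (0 : ℝ)..T, γ t.toNNReal ω * h t) μ := by
    simp only [hI]
    exact hprod.integral_prod_right.const_mul _
  have hzero : ∫ ω, (∫ t in (0 : ℝ)..T, γ t.toNNReal ω * h t) ∂μ = 0 := by
    simp only [hI]
    rw [integral_const_mul, ← integral_integral_swap hprod]
    simp [integral_mul_const, hγ0]
  have heq : (fun ω => a * β T.toNNReal ω - ∫ t in (0 : ℝ)..T, β t.toNNReal ω * h t) =ᵐ[μ]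
      fun ω => a * γ T.toNNReal ω - ∫ t in (0 : ℝ)..T, γ t.toNNReal ω * h t := by
    filter_upwards [hγ] with ω hω
    simp only [hω]
  refine ⟨(((hγi _).const_mul a).sub hint).congr heq.symm, ?_⟩
  rw [integral_congr_ae heq, integral_sub ((hγi _).const_mul a) hint, hzero, integral_const_mul,
    hγ0]
  simp

end Noise

/-! ### The log-likelihood of one waveform -/

section Likelihood

variable {E : Type*} [NormedAddCommGroup E] [NormedSpace ℝ E]

/-- Integration by parts on the smooth part of the observation; the boundary term at `T` cancels the
one in `correlate`, and the one at `0` vanishes by `R 0 = 0`. -/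
theorem correlate_add (T : ℝ) {R m : ℝ → ℝ} {σ : ℝ} {b : ℝ → ℝ} (hR : ContDiff ℝ 1 R)
    (hR0 : R 0 = 0) (hb : Continuous b) (hm : ContDiff ℝ 1 m) :
    correlate T (fun t => R t + σ * b t) m =
      (∫ t in (0 : ℝ)..T, deriv R t * m t) + σ * correlate T b m := by
  have hm' : Continuous (deriv m) := hm.continuous_deriv (by norm_num)
  have hR' : Continuous (deriv R) := hR.continuous_deriv (by norm_num)
  have h1 : ∫ t in (0 : ℝ)..T, (R t + σ * b t) * deriv m t =
      (∫ t in (0 : ℝ)..T, R t * deriv m t) + σ * ∫ t in (0 : ℝ)..T, b t * deriv m t := by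
    rw [← intervalIntegral.integral_const_mul, ← intervalIntegral.integral_add]
    · exact intervalIntegral.integral_congr fun t _ => by ring
    · exact (hR.continuous.mul hm').intervalIntegrable _ _
    · exact (continuous_const.mul (hb.mul hm')).intervalIntegrable _ _
  have h2 := intervalIntegral.integral_mul_deriv_eq_deriv_mul (a := 0) (b := T) (u := R) (v := m)
    (u' := deriv R) (v' := deriv m)
    (fun x _ => (hR.differentiable (by norm_num) x).hasDerivAt)
    (fun x _ => (hm.differentiable (by norm_num) x).hasDerivAt)
    (hR'.intervalIntegrable _ _) (hm'.intervalIntegrable _ _)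
  simp only [correlate]
  rw [h1, h2, hR0]
  ring

/-- Log-likelihood of a signal model `m` given that the observed waveform is the noise-free signal
`m x₀` plus `σ` times white noise with primitive `b`. -/
def logLik (N₀ T σ : ℝ) (m : E → ℝ → ℝ) (x₀ : E) (b : ℝ → ℝ) (x : E) : ℝ :=
  2 / N₀ * correlate T (fun t => (∫ u in (0 : ℝ)..t, m x₀ u) + σ * b t) (m x) -
    1 / N₀ * ∫ t in (0 : ℝ)..T, m x t ^ 2

variable {N₀ T σ : ℝ} {m : E → ℝ → ℝ} {b : ℝ → ℝ}

/-- The noise pairing involves the time derivative of the signal, which costs one order; this is why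
`s ∈ C³` is needed for two derivatives in the parameters. -/
theorem contDiff_deriv_slice (hm : ContDiff ℝ 3 (Function.uncurry m)) :
    ContDiff ℝ 2 (Function.uncurry fun x t => deriv (m x) t) := by
  have : (Function.uncurry fun x t => deriv (m x) t) =
      fun p => fderiv ℝ (Function.uncurry m) p (0, 1) := by
    funext ⟨x, t⟩
    have h := ((hm.differentiable (by norm_num)) (x, t)).hasFDerivAt.comp_hasDerivAt t
      ((hasDerivAt_const t x).prodMk (hasDerivAt_id t))
    exact h.deriv
  rw [this]
  exact (hm.fderiv_right (m := 2) (by norm_num)).clm_apply contDiff_const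

/-- The noise part of the log-likelihood. -/
def noisePart (T : ℝ) (m : E → ℝ → ℝ) (b : ℝ → ℝ) (x : E) : ℝ :=
  m x T * b T - ∫ t in (0 : ℝ)..T, b t * deriv (m x) t

theorem contDiff_apply_time (hm : ContDiff ℝ 3 (Function.uncurry m)) (t : ℝ) :
    ContDiff ℝ 3 (fun x => m x t) :=
  hm.comp (contDiff_id.prodMk contDiff_const)

theorem contDiff_apply_param (hm : ContDiff ℝ 3 (Function.uncurry m)) (x : E) :
    ContDiff ℝ 3 (m x) :=
  hm.comp (contDiff_const.prodMk contDiff_id)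

/-- Completing the square, `2 m₀ m - m² = m₀² - (m - m₀)²`, separates a deterministic penalty that
is stationary at the true parameter from a term linear in the noise. The factor `1 *` is the
constant weight in the lemmas on parametric integrals. -/
theorem logLik_eq (hm : ContDiff ℝ 3 (Function.uncurry m)) (hb : Continuous b) (x₀ x : E) :
    logLik N₀ T σ m x₀ b x =
      (∫ t in (0 : ℝ)..T, 1 * (1 / N₀ * (m x₀ t ^ 2 - (m x t - m x₀ t) ^ 2))) +
        2 * σ / N₀ * noisePart T m b x := by
  have hc : ∀ y, Continuous (m y) := fun y => (contDiff_apply_param hm y).continuous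
  have hR : ∀ t, HasDerivAt (fun t => ∫ u in (0 : ℝ)..t, m x₀ u) (m x₀ t) t := fun t =>
    intervalIntegral.integral_hasDerivAt_right ((hc x₀).intervalIntegrable _ _)
      ((hc x₀).stronglyMeasurableAtFilter _ _) (hc x₀).continuousAt
  have hR' : deriv (fun t => ∫ u in (0 : ℝ)..t, m x₀ u) = m x₀ := funext fun t => (hR t).deriv
  have hR1 : ContDiff ℝ 1 (fun t => ∫ u in (0 : ℝ)..t, m x₀ u) := by
    rw [contDiff_one_iff_deriv, hR']
    exact ⟨fun t => (hR t).differentiableAt, hc x₀⟩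
  have hk := correlate_add T (σ := σ) hR1 (by simp) hb
    ((contDiff_apply_param hm x).of_le (by norm_num))
  rw [hR'] at hk
  have hn : noisePart T m b x = correlate T b (m x) := rfl
  have h1 : ∫ t in (0 : ℝ)..T, 1 * (1 / N₀ * (m x₀ t ^ 2 - (m x t - m x₀ t) ^ 2)) =
      2 / N₀ * (∫ t in (0 : ℝ)..T, m x₀ t * m x t) - 1 / N₀ * ∫ t in (0 : ℝ)..T, m x t ^ 2 := by
    rw [← intervalIntegral.integral_const_mul, ← intervalIntegral.integral_const_mul,
      ← intervalIntegral.integral_sub]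
    · exact intervalIntegral.integral_congr fun t _ => by ring
    · exact (continuous_const.mul ((hc x₀).mul (hc x))).intervalIntegrable _ _
    · exact (continuous_const.mul ((hc x).pow 2)).intervalIntegrable _ _
  rw [logLik, hk, hn, h1]
  ring

theorem contDiff_signalPart (hm : ContDiff ℝ 3 (Function.uncurry m)) (x₀ : E) :
    ContDiff ℝ 2 (Function.uncurry fun x t => 1 / N₀ * (m x₀ t ^ 2 - (m x t - m x₀ t) ^ 2)) := by
  have h0 : ContDiff ℝ 3 (fun p : E × ℝ => m x₀ p.2) :=
    (contDiff_apply_param hm x₀).comp contDiff_snd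
  have h : ContDiff ℝ 3 (fun p : E × ℝ =>
      1 / N₀ * (m x₀ p.2 ^ 2 - (m p.1 p.2 - m x₀ p.2) ^ 2)) :=
    contDiff_const.mul ((h0.pow 2).sub ((hm.sub h0).pow 2))
  exact h.of_le (by norm_num)

variable [FiniteDimensional ℝ E]

theorem contDiff_noisePart (hm : ContDiff ℝ 3 (Function.uncurry m)) (hb : Continuous b) :
    ContDiff ℝ 2 (noisePart T m b) :=
  (((contDiff_apply_time hm T).of_le (by norm_num)).mul contDiff_const).sub
    (contDiff_integral_param T hb 2 (contDiff_deriv_slice hm))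

theorem fderiv_noisePart (hm : ContDiff ℝ 3 (Function.uncurry m)) (hb : Continuous b) (x v : E) :
    fderiv ℝ (noisePart T m b) x v = fderiv ℝ (fun y => m y T) x v * b T -
      ∫ t in (0 : ℝ)..T, b t * fderiv ℝ (fun y => deriv (m y) t) x v := by
  have h1 : DifferentiableAt ℝ (fun y => m y T) x :=
    (contDiff_apply_time hm T).differentiable (by norm_num) x
  have hd : ContDiff ℝ 1 (Function.uncurry fun x t => deriv (m x) t) :=
    (contDiff_deriv_slice hm).of_le (by norm_num)
  have h2 := (hasFDerivAt_integral_param T hb hd x)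
  have h3 := (h1.hasFDerivAt.mul_const (b T)).sub h2
  have h4 : fderiv ℝ (noisePart T m b) x = _ := h3.fderiv
  rw [h4, sub_apply, ← h2.fderiv, fderiv_integral_param T hb hd]
  simp [mul_comm]

theorem d2_noisePart (hm : ContDiff ℝ 3 (Function.uncurry m)) (hb : Continuous b) (x v w : E) :
    d2 (noisePart T m b) x v w = d2 (fun y => m y T) x v w * b T -
      ∫ t in (0 : ℝ)..T, b t * d2 (fun y => deriv (m y) t) x v w := by
  have h1 : ContDiff ℝ 2 (fun y => m y T) := (contDiff_apply_time hm T).of_le (by norm_num)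
  have hd := contDiff_deriv_slice hm
  have hf : noisePart T m b = fun x => b T * m x T +
      (-1) * ∫ t in (0 : ℝ)..T, b t * deriv (m x) t := by
    funext x; simp [noisePart]; ring
  have hI := contDiff_integral_param T hb 2 hd
  rw [hf, d2_add (contDiff_const.mul h1).contDiffAt (contDiff_const.mul hI).contDiffAt, d2_const_mul h1.contDiffAt,
    d2_const_mul hI.contDiffAt, d2_integral_param T hb hd]
  ring

theorem contDiff_logLik (hm : ContDiff ℝ 3 (Function.uncurry m)) (hb : Continuous b) (x₀ : E) :
    ContDiff ℝ 2 (logLik N₀ T σ m x₀ b) := by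
  have : logLik N₀ T σ m x₀ b = _ := funext (logLik_eq hm hb x₀)
  rw [this]
  exact (contDiff_integral_param T continuous_const 2 (contDiff_signalPart hm x₀)).add
    (contDiff_const.mul (contDiff_noisePart hm hb))

theorem hasDerivAt_penalty (u₀ u : ℝ) : HasDerivAt (fun u => 1 / N₀ * (u₀ ^ 2 - (u - u₀) ^ 2))
    (-(2 / N₀) * (u - u₀)) u := by
  have h := (((hasDerivAt_id u).sub_const u₀).pow 2).const_sub (u₀ ^ 2) |>.const_mul (1 / N₀)
  exact h.congr_deriv (by simp; ring)

theorem contDiff_penalty (u₀ : ℝ) :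
    ContDiff ℝ 2 (fun u : ℝ => 1 / N₀ * (u₀ ^ 2 - (u - u₀) ^ 2)) := by
  fun_prop

/-- At the true parameter the penalty has zero gradient, so the score consists of noise alone. -/
theorem fderiv_logLik (hm : ContDiff ℝ 3 (Function.uncurry m)) (hb : Continuous b) (x₀ v : E) :
    fderiv ℝ (logLik N₀ T σ m x₀ b) x₀ v = 2 * σ / N₀ * (fderiv ℝ (fun y => m y T) x₀ v * b T -
      ∫ t in (0 : ℝ)..T, b t * fderiv ℝ (fun y => deriv (m y) t) x₀ v) := by
  have : logLik N₀ T σ m x₀ b = _ := funext (logLik_eq hm hb x₀)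
  have hs := contDiff_signalPart (N₀ := N₀) hm x₀
  have hs1 := contDiff_integral_param T (φ := fun _ => (1 : ℝ)) continuous_const 2 hs
  have hn := contDiff_noisePart (T := T) hm hb
  have hz : ∀ t, fderiv ℝ (fun x => 1 / N₀ * (m x₀ t ^ 2 - (m x t - m x₀ t) ^ 2)) x₀ v = 0 := by
    intro t
    have h := (hasDerivAt_penalty (N₀ := N₀) (m x₀ t) (m x₀ t)).comp_hasFDerivAt x₀
      ((contDiff_apply_time hm t).differentiable (by norm_num) x₀).hasFDerivAt
    have h' := h.fderiv
    simp only [Function.comp_def] at h'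
    rw [h']
    simp
  rw [this, fderiv_fun_add (hs1.differentiable (by norm_num) x₀)
    ((contDiff_const.mul hn).differentiable (by norm_num) x₀),
    fderiv_const_mul (hn.differentiable (by norm_num) x₀), add_apply, smul_apply,
    fderiv_noisePart hm hb, fderiv_integral_param T continuous_const (hs.of_le (by norm_num))]
  simp only [hz]
  simp

/-- The penalty has zero slope at the true parameter, so second derivatives of `m` drop out of the
signal part; only the inner product of first derivatives and a noise pairing remain. -/
theorem d2_logLik (hm : ContDiff ℝ 3 (Function.uncurry m)) (hb : Continuous b) (x₀ v w : E) :
    d2 (logLik N₀ T σ m x₀ b) x₀ v w =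
      -(2 / N₀) * (∫ t in (0 : ℝ)..T,
        fderiv ℝ (fun y => m y t) x₀ v * fderiv ℝ (fun y => m y t) x₀ w) +
      2 * σ / N₀ * (d2 (fun y => m y T) x₀ v w * b T -
      ∫ t in (0 : ℝ)..T, b t * d2 (fun y => deriv (m y) t) x₀ v w) := by
  have : logLik N₀ T σ m x₀ b = _ := funext (logLik_eq hm hb x₀)
  have hs := contDiff_signalPart (N₀ := N₀) hm x₀
  have hs1 := contDiff_integral_param T (φ := fun _ => (1 : ℝ)) continuous_const 2 hs
  have hn := contDiff_noisePart (T := T) hm hb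
  have hz : ∀ t, d2 (fun x => 1 / N₀ * (m x₀ t ^ 2 - (m x t - m x₀ t) ^ 2)) x₀ v w =
      -(2 / N₀) * (fderiv ℝ (fun y => m y t) x₀ v * fderiv ℝ (fun y => m y t) x₀ w) := by
    intro t
    rw [d2_comp (g := fun u => 1 / N₀ * (m x₀ t ^ 2 - (u - m x₀ t) ^ 2)) (y := fun y => m y t)
      (contDiff_penalty _).contDiffAt ((contDiff_apply_time hm t).of_le (by norm_num)).contDiffAt]
    have h1 : (fun u => fderiv ℝ (fun u => 1 / N₀ * (m x₀ t ^ 2 - (u - m x₀ t) ^ 2)) u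
        (fderiv ℝ (fun y => m y t) x₀ w)) =
        fun u => -(2 / N₀) * (u - m x₀ t) * fderiv ℝ (fun y => m y t) x₀ w := by
      funext u
      rw [(hasDerivAt_penalty (m x₀ t) u).hasFDerivAt.fderiv]
      simp [mul_comm]
    have h2 : HasDerivAt (fun u => -(2 / N₀) * (u - m x₀ t) * fderiv ℝ (fun y => m y t) x₀ w)
        (-(2 / N₀) * 1 * fderiv ℝ (fun y => m y t) x₀ w) (m x₀ t) :=
      (((hasDerivAt_id _).sub_const _).const_mul _).mul_const _
    rw [(hasDerivAt_penalty (m x₀ t) (m x₀ t)).hasFDerivAt.fderiv]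
    rw [d2, h1, h2.hasFDerivAt.fderiv]
    simp
    ring
  rw [this, d2_add hs1.contDiffAt (contDiff_const.mul hn).contDiffAt,
    d2_const_mul hn.contDiffAt, d2_noisePart hm hb,
    d2_integral_param T continuous_const hs]
  simp only [hz, one_mul, intervalIntegral.integral_const_mul]

end Likelihood

/-! ### The waveform of one link -/

theorem contDiff_rxSignal {L : ℕ} (c : ℝ) {s : ℝ → ℝ} (hs : ContDiff ℝ 3 s) :
    ContDiff ℝ 3 (Function.uncurry (rxSignal (L := L) c s)) := by
  have : Function.uncurry (rxSignal (L := L) c s) = fun p : (Fin L ⊕ Fin L → ℝ) × ℝ =>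
      ∑ l, c * p.1 (.inr l) * s (p.2 - p.1 (.inl l)) := rfl
  rw [this]
  have hx : ∀ i : Fin L ⊕ Fin L, ContDiff ℝ 3 (fun p : (Fin L ⊕ Fin L → ℝ) × ℝ => p.1 i) :=
    fun i => (contDiff_apply ℝ ℝ i).comp contDiff_fst
  exact ContDiff.sum fun l _ =>
    (contDiff_const.mul (hx _)).mul (hs.comp (contDiff_snd.sub (hx _)))

theorem log_lik_observed {L : ℕ} (c N₀ T : ℝ) (s : ℝ → ℝ) (x₀ : Fin L ⊕ Fin L → ℝ)
    (β : ℝ≥0 → ℝ) :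
    (fun x => Real.log (lik c N₀ T s (observed c N₀ s x₀ β) x)) =
      logLik N₀ T (Real.sqrt (N₀ / 2)) (rxSignal c s) x₀ (fun t => β t.toNNReal) := by
  funext x
  rw [lik, Real.log_exp]
  rfl

theorem continuous_toNNReal_path {β : ℝ≥0 → ℝ} (hβ : Continuous β) :
    Continuous fun t : ℝ => β t.toNNReal :=
  hβ.comp continuous_real_toNNReal

/-- `delayAmp` as a continuous linear map. -/
def delayAmpL {L : ℕ} {los : Bool} (c : ℝ) :
    (ℝ × (ChanCoord L los → ℝ)) →L[ℝ] (Fin L ⊕ Fin L → ℝ) :=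
  LinearMap.toContinuousLinearMap
    { toFun := fun y => delayAmp c y.1 y.2
      map_add' := by
        intro x y
        funext i
        rcases i with l | l <;> simp only [delayAmp, fullParam, Pi.add_apply, Prod.fst_add,
          Prod.snd_add] <;> split_ifs <;> ring
      map_smul' := by
        intro a y
        funext i
        rcases i with l | l <;> simp only [delayAmp, fullParam, Pi.smul_apply, Prod.smul_fst,
          Prod.smul_snd, smul_eq_mul, RingHom.id_apply] <;> split_ifs <;> ring }

theorem delayAmpL_apply {L : ℕ} {los : Bool} (c : ℝ) (y : ℝ × (ChanCoord L los → ℝ)) :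
    delayAmpL c y = delayAmp c y.1 y.2 := rfl

namespace Network

variable {Na Nb : ℕ} (N : Network Na Nb)

/-- The directions of the delays and scaled amplitudes, up to the factor `1 / c`, that correspond to
the coordinates of `(d, κ)`. -/
def waveDir (e : Fin Na × Node Na Nb) : Unit ⊕ N.Coord e → Fin (N.L e) ⊕ Fin (N.L e) → ℝ
  | .inl _ => lVec (N.L e)
  | .inr i => Pi.single i.val 1

/-- A change of `d` shifts all delays alike, which is the vector `l`; an unknown bias or amplitude
moves its own coordinate. Scaling the amplitudes by `1 / c` gives every direction the same factor,
the origin of `1 / c²` in the RII. -/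
theorem delayAmpL_linkDir (e : Fin Na × Node Na Nb) (p : Unit ⊕ N.Coord e) :
    delayAmpL N.c (N.linkDir e p) = ∑ i, (N.waveDir e p i / N.c) • Pi.single i (1 : ℝ) := by
  have h : ∀ w : Fin (N.L e) ⊕ Fin (N.L e) → ℝ,
      ∑ i, (w i / N.c) • Pi.single i (1 : ℝ) = fun i => w i / N.c := by
    intro w
    funext j
    simp [Finset.sum_apply, Pi.single_apply]
  rw [h]
  funext j
  rw [delayAmpL_apply]
  rcases p with _ | i
  · rcases j with l | l <;> simp [linkDir, delayAmp, waveDir, lVec, fullParam]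
  · have hf : ∀ j, fullParam (Pi.single i (1 : ℝ)) j = (Pi.single i.val 1 : _ → ℝ) j := by
      intro j
      rw [fullParam]
      split_ifs with h
      · by_cases hj : j = i.val
        · subst hj; simp
        · rw [Pi.single_eq_of_ne hj, Pi.single_eq_of_ne]
          rintro rfl
          exact hj rfl
      · rw [Pi.single_eq_of_ne]
        rintro rfl
        exact h i.2
    rcases j with l | l <;> simp [linkDir, delayAmp, waveDir, hf]

/-- Log-likelihood of the waveform of the link `e`, observed at the true values `y₀ = (d, κ)`. -/
def waveLL (e : Fin Na × Node Na Nb) (y₀ : ℝ × (N.Coord e → ℝ)) (β : ℝ≥0 → ℝ)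
    (y : ℝ × (N.Coord e → ℝ)) : ℝ :=
  Real.log (N.linkLik e (N.linkObs e y₀ β) y)

theorem waveLL_eq (e : Fin Na × Node Na Nb) (y₀ : ℝ × (N.Coord e → ℝ)) (β : ℝ≥0 → ℝ) :
    N.waveLL e y₀ β = fun y => logLik N.N₀ N.T (Real.sqrt (N.N₀ / 2)) (rxSignal N.c N.s)
      (delayAmpL N.c y₀) (fun t => β t.toNNReal) (delayAmpL N.c y) := by
  funext y
  exact congrFun (log_lik_observed N.c N.N₀ N.T N.s (delayAmp N.c y₀.1 y₀.2) β)
    (delayAmp N.c y.1 y.2)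

variable {N}

theorem contDiff_waveLL (e : Fin Na × Node Na Nb) (y₀ : ℝ × (N.Coord e → ℝ)) {β : ℝ≥0 → ℝ}
    (hβ : Continuous β) : ContDiff ℝ 2 (N.waveLL e y₀ β) := by
  rw [waveLL_eq]
  exact (contDiff_logLik (contDiff_rxSignal N.c N.s_smooth)
    (continuous_toNNReal_path hβ) _).comp (delayAmpL N.c).contDiff

theorem fderiv_waveLL {e : Fin Na × Node Na Nb} (y₀ : ℝ × (N.Coord e → ℝ)) {β : ℝ≥0 → ℝ}
    (hβ : Continuous β) (v : ℝ × (N.Coord e → ℝ)) :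
    fderiv ℝ (N.waveLL e y₀ β) y₀ v = fderiv ℝ (logLik N.N₀ N.T (Real.sqrt (N.N₀ / 2))
      (rxSignal N.c N.s) (delayAmpL N.c y₀) (fun t => β t.toNNReal)) (delayAmpL N.c y₀)
      (delayAmpL N.c v) := by
  have h := contDiff_logLik (N₀ := N.N₀) (T := N.T) (σ := Real.sqrt (N.N₀ / 2))
    (contDiff_rxSignal N.c N.s_smooth) (continuous_toNNReal_path hβ) (delayAmpL N.c y₀)
  rw [waveLL_eq, fderiv_fun_comp y₀ (h.differentiable (by norm_num) _)
    (delayAmpL N.c).differentiableAt, ContinuousLinearMap.fderiv]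
  rfl

/-- The change of variables is linear, so the chain rule has no curvature term and the Hessian
transforms as a bilinear form. -/
theorem hess_waveLL (e : Fin Na × Node Na Nb) (y₀ : ℝ × (N.Coord e → ℝ)) {β : ℝ≥0 → ℝ}
    (hβ : Continuous β) (p q : Unit ⊕ N.Coord e) :
    hess (N.linkDir e) (N.waveLL e y₀ β) y₀ p q =
      ∑ i, ∑ j, N.waveDir e p i / N.c * (N.waveDir e q j / N.c) *
        hess (fun i => Pi.single i (1 : ℝ))
          (fun x => Real.log (lik N.c N.N₀ N.T N.s (N.linkObs e y₀ β) x))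
          (delayAmp N.c y₀.1 y₀.2) i j := by
  have h := contDiff_logLik (N₀ := N.N₀) (T := N.T) (σ := Real.sqrt (N.N₀ / 2))
    (contDiff_rxSignal N.c N.s_smooth) (continuous_toNNReal_path hβ) (delayAmpL N.c y₀)
  have hz : ∀ v w, d2 (fun y => delayAmpL (los := N.los e) N.c y) y₀ v w = 0 := by
    intro v w
    simp [d2]
  simp only [hess_eq_d2, linkObs, log_lik_observed]
  rw [waveLL_eq, d2_comp h.contDiffAt (delayAmpL N.c).contDiff.contDiffAt, hz, map_zero, add_zero,
    ContinuousLinearMap.fderiv, delayAmpL_linkDir, delayAmpL_linkDir, d2_sum_sum h.contDiffAt]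
  rfl

/-! ### Mean score and mean information of one waveform -/

section Expectation

variable {Ω : Type*} [MeasurableSpace Ω] {μ : Measure Ω} {B : N.links → ℝ≥0 → Ω → ℝ}

theorem IsNoise.ae_continuous (hB : N.IsNoise B μ) : ∀ᵐ ω ∂μ, ∀ e, Continuous (B e · ω) :=
  ae_all_iff.2 fun e => (hB.brownian e).cont

/-- At the true parameter the score is almost surely a multiple of a Brownian pairing, hence
centred. -/
theorem IsNoise.score [IsProbabilityMeasure μ] (hB : N.IsNoise B μ) (e : N.links) (y₀ : ℝ × (N.Coord e → ℝ))
    (v : ℝ × (N.Coord e → ℝ)) :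
    Integrable (fun ω => fderiv ℝ (N.waveLL e y₀ (B e · ω)) y₀ v) μ ∧
      ∫ ω, fderiv ℝ (N.waveLL e y₀ (B e · ω)) y₀ v ∂μ = 0 := by
  have hm := contDiff_rxSignal (L := N.L e) N.c N.s_smooth
  have hc : Continuous fun t => fderiv ℝ (fun y => deriv (rxSignal N.c N.s y) t)
      (delayAmpL N.c y₀) (delayAmpL N.c v) := by
    have := contDiff_slice_fderiv (n := 1) (by exact_mod_cast contDiff_deriv_slice hm)
      (delayAmpL N.c v)
    exact this.continuous.comp (Continuous.prodMk_right (delayAmpL N.c y₀))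
  have h := integrable_brownian_pairing (hB.meas e) (hB.brownian e) N.T
    (fderiv ℝ (fun y => rxSignal N.c N.s y N.T) (delayAmpL N.c y₀) (delayAmpL N.c v)) hc
  have hae : (fun ω => fderiv ℝ (N.waveLL e y₀ (B e · ω)) y₀ v) =ᵐ[μ] fun ω =>
      2 * Real.sqrt (N.N₀ / 2) / N.N₀ * (fderiv ℝ (fun y => rxSignal N.c N.s y N.T)
        (delayAmpL N.c y₀) (delayAmpL N.c v) * B e N.T.toNNReal ω -
        ∫ t in (0 : ℝ)..N.T, B e t.toNNReal ω * fderiv ℝ (fun y => deriv (rxSignal N.c N.s y) t)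
      (delayAmpL N.c y₀) (delayAmpL N.c v)) := by
    filter_upwards [hB.ae_continuous] with ω hω
    rw [fderiv_waveLL (N := N) (e := e) y₀ (hω e), fderiv_logLik hm (continuous_toNNReal_path (hω e))]
  refine ⟨(h.1.const_mul _).congr hae.symm, ?_⟩
  rw [integral_congr_ae hae, integral_const_mul, h.2, mul_zero]

/-- Averaging removes the noise pairing from the Hessian. What remains is a Gram form in the signal
derivatives, the source of positivity. -/
theorem IsNoise.integral_hess [IsProbabilityMeasure μ] (hB : N.IsNoise B μ) (e : N.links)
    (x₀ : Fin (N.L e) ⊕ Fin (N.L e) → ℝ) (v w : Fin (N.L e) ⊕ Fin (N.L e) → ℝ) :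
    ∫ ω, -d2 (fun x => Real.log (lik N.c N.N₀ N.T N.s
        (observed N.c N.N₀ N.s x₀ (B e · ω)) x)) x₀ v w ∂μ =
      2 / N.N₀ * ∫ t in (0 : ℝ)..N.T, fderiv ℝ (fun y => rxSignal N.c N.s y t) x₀ v *
        fderiv ℝ (fun y => rxSignal N.c N.s y t) x₀ w := by
  have hm := contDiff_rxSignal (L := N.L e) N.c N.s_smooth
  have hc : Continuous fun t => d2 (fun y => deriv (rxSignal N.c N.s y) t) x₀ v w := by
    have h1 := contDiff_slice_fderiv (n := 1) (by exact_mod_cast contDiff_deriv_slice hm) w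
    have h2 := contDiff_slice_fderiv (n := 0) (by exact_mod_cast h1) v
    exact h2.continuous.comp (Continuous.prodMk_right x₀)
  have h := integrable_brownian_pairing (hB.meas e) (hB.brownian e) N.T
    (d2 (fun y => rxSignal N.c N.s y N.T) x₀ v w) hc
  have hae : (fun ω => -d2 (fun x => Real.log (lik N.c N.N₀ N.T N.s
        (observed N.c N.N₀ N.s x₀ (B e · ω)) x)) x₀ v w) =ᵐ[μ] fun ω =>
      2 / N.N₀ * (∫ t in (0 : ℝ)..N.T, fderiv ℝ (fun y => rxSignal N.c N.s y t) x₀ v *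
        fderiv ℝ (fun y => rxSignal N.c N.s y t) x₀ w) +
      -(2 * Real.sqrt (N.N₀ / 2) / N.N₀) * (d2 (fun y => rxSignal N.c N.s y N.T) x₀ v w *
        B e N.T.toNNReal ω - ∫ t in (0 : ℝ)..N.T, B e t.toNNReal ω *
          d2 (fun y => deriv (rxSignal N.c N.s y) t) x₀ v w) := by
    filter_upwards [hB.ae_continuous] with ω hω
    rw [log_lik_observed, d2_logLik hm (continuous_toNNReal_path (hω e))]
    ring
  rw [integral_congr_ae hae, integral_add (integrable_const _) (h.1.const_mul _),
    integral_const_mul (-_), h.2]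
  simp

end Expectation

/-! ### The channel prior of one link -/

section Channel

variable {e : Fin Na × Node Na Nb}

/-- Logarithm of the channel prior, as a function of `(d, κ)`. -/
def logChan (N : Network Na Nb) (e : Fin Na × Node Na Nb) (y : ℝ × (N.Coord e → ℝ)) : ℝ :=
  Real.log (N.chan e y.2 y.1)

theorem IsChannelPrior.contDiffAt (h : N.IsChannelPrior e) {d : ℝ} (hd : 0 < d)
    {κ : N.Coord e → ℝ} (hκ : 0 < N.chan e κ d) :
    ContDiffAt ℝ 2 (fun y : ℝ × (N.Coord e → ℝ) => N.chan e y.2 y.1) (d, κ) :=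
  h.smooth.contDiffAt (h.isOpen_pos.mem_nhds ⟨hd, hκ⟩)

theorem IsChannelPrior.contDiffAt_log (h : N.IsChannelPrior e) {d : ℝ} (hd : 0 < d)
    {κ : N.Coord e → ℝ} (hκ : 0 < N.chan e κ d) : ContDiffAt ℝ 2 (N.logChan e) (d, κ) :=
  (h.contDiffAt hd hκ).log hκ.ne'

theorem IsChannelPrior.measurable_left (h : N.IsChannelPrior e) (d : ℝ) :
    Measurable fun κ => N.chan e κ d :=
  h.meas.comp (measurable_id.prodMk measurable_const)

theorem IsChannelPrior.ae_pos (h : N.IsChannelPrior e) (d : ℝ) :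
    ∀ᵐ κ ∂(N.chanLaw e d), 0 < N.chan e κ d := by
  rw [chanLaw, ae_withDensity_iff (h.measurable_left d).ennreal_ofReal]
  refine Filter.Eventually.of_forall fun κ hκ => ?_
  simpa using hκ

theorem IsChannelPrior.integral_chanLaw (h : N.IsChannelPrior e) (d : ℝ)
    (g : (N.Coord e → ℝ) → ℝ) :
    ∫ κ, g κ ∂(N.chanLaw e d) = ∫ κ, N.chan e κ d * g κ := by
  rw [chanLaw, integral_withDensity_eq_integral_toReal_smul
    (h.measurable_left d).ennreal_ofReal (by simp)]
  refine integral_congr_ae (Filter.Eventually.of_forall fun κ => ?_)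
  simp [ENNReal.toReal_ofReal (h.nonneg κ d)]

theorem IsChannelPrior.integrable_chanLaw_iff (h : N.IsChannelPrior e) (d : ℝ)
    (g : (N.Coord e → ℝ) → ℝ) :
    Integrable g (N.chanLaw e d) ↔ Integrable fun κ => N.chan e κ d * g κ := by
  rw [chanLaw, integrable_withDensity_iff_integrable_smul'
    (h.measurable_left d).ennreal_ofReal (by simp)]
  refine integrable_congr (Filter.Eventually.of_forall fun κ => ?_)
  simp [ENNReal.toReal_ofReal (h.nonneg κ d)]

theorem IsChannelPrior.integral_eq_one (h : N.IsChannelPrior e) {d : ℝ} (hd : 0 < d) :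
    ∫ κ, N.chan e κ d = 1 := by
  have := h.prob d hd
  have h1 := h.integral_chanLaw d fun _ => 1
  simpa using h1.symm

theorem IsChannelPrior.integrable_chan (h : N.IsChannelPrior e) {d : ℝ} (hd : 0 < d) :
    Integrable fun κ => N.chan e κ d := by
  have := h.prob d hd
  have h1 := (h.integrable_chanLaw_iff d fun _ => 1).1 (integrable_const 1)
  simpa using h1

/-- Where the density is positive this is the logarithmic derivative. Where it vanishes,
nonnegativity makes `d` a minimum, so both sides are zero; thus no boundary of the support needs
separate treatment. -/
theorem IsChannelPrior.chan_mul_score (h : N.IsChannelPrior e) {d : ℝ} (hd : 0 < d)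
    (κ : N.Coord e → ℝ) :
    N.chan e κ d * fderiv ℝ (N.logChan e) (d, κ) (1, 0) = deriv (N.chan e κ) d := by
  rcases (h.nonneg κ d).eq_or_lt with h0 | h0
  · rw [← h0, zero_mul]
    refine (IsLocalMin.deriv_eq_zero (Filter.Eventually.of_forall fun d' => ?_)).symm
    rw [← h0]
    exact h.nonneg κ d'
  · have hc : HasFDerivAt (fun y : ℝ × (N.Coord e → ℝ) => N.chan e y.2 y.1) _ (d, κ) :=
      ((h.contDiffAt hd h0).differentiableAt (by norm_num)).hasFDerivAt
    have h1 : HasDerivAt (N.chan e κ) _ d :=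
      HasFDerivAt.comp_hasDerivAt (f := fun d => (d, κ)) d hc
        ((hasDerivAt_id d).prodMk (hasDerivAt_const d κ))
    have h2 : HasFDerivAt (N.logChan e) _ (d, κ) := hc.log h0.ne'
    rw [h2.fderiv, h1.deriv]
    simp [h0.ne']

/-- The total mass is `1` for all nearby distances, and it may be differentiated under the integral
sign. -/
theorem IsChannelPrior.integral_deriv (h : N.IsChannelPrior e) {d : ℝ} (hd : 0 < d) :
    Integrable (fun κ => deriv (N.chan e κ) d) ∧ ∫ κ, deriv (N.chan e κ) d = 0 := by
  obtain ⟨ε, hε, bound, hb, hdom⟩ := h.dominated d hd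
  have hmeas : AEStronglyMeasurable (fun κ => deriv (N.chan e κ) d) volume := by
    -- Measurability of the derivative in `κ`: it is almost everywhere the limit of difference
    -- quotients with steps `1 / (n + 1)`.
    have hlim : ∀ᵐ κ, Filter.Tendsto (fun n : ℕ => ((1 : ℝ) / (n + 1))⁻¹ *
        (N.chan e κ (d + 1 / (n + 1)) - N.chan e κ d)) Filter.atTop
        (nhds (deriv (N.chan e κ) d)) := by
      filter_upwards [hdom] with κ hκ
      have h1 := (hκ d (Metric.mem_ball_self hε)).1.hasDerivAt.tendsto_slope_zero
      have h2 : Filter.Tendsto (fun n : ℕ => (1 : ℝ) / (n + 1)) Filter.atTop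
          (nhdsWithin 0 {0}ᶜ) := by
        rw [tendsto_nhdsWithin_iff]
        refine ⟨tendsto_one_div_add_atTop_nhds_zero_nat, Filter.Eventually.of_forall fun n => ?_⟩
        have : (1 : ℝ) / (n + 1) ≠ 0 := by positivity
        simpa using this
      exact h1.comp h2
    refine aestronglyMeasurable_of_tendsto_ae Filter.atTop (fun n => ?_) hlim
    exact (((h.measurable_left _).sub (h.measurable_left d)).const_mul _).aestronglyMeasurable
  have hk := hasDerivAt_integral_of_dominated_loc_of_deriv_le (μ := volume)
    (F := fun d κ => N.chan e κ d) (F' := fun d κ => deriv (N.chan e κ) d) (x₀ := d)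
    (bound := bound) (Metric.ball_mem_nhds d hε)
    (Filter.Eventually.of_forall fun d' => (h.measurable_left d').aestronglyMeasurable)
    (h.integrable_chan hd) hmeas
    (hdom.mono fun κ hκ d' hd' => (hκ d' hd').2) hb
    (hdom.mono fun κ hκ d' hd' => (hκ d' hd').1.hasDerivAt)
  refine ⟨hk.1, ?_⟩
  have hconst : (fun d' => ∫ κ, N.chan e κ d') =ᶠ[nhds d] fun _ => 1 := by
    filter_upwards [lt_mem_nhds hd] with d' hd'
    exact h.integral_eq_one hd'
  have := hk.2.deriv
  rw [hconst.deriv_eq] at this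
  simpa using this.symm

theorem IsChannelPrior.score (h : N.IsChannelPrior e) {d : ℝ} (hd : 0 < d) :
    Integrable (fun κ => fderiv ℝ (N.logChan e) (d, κ) (1, 0)) (N.chanLaw e d) ∧
      ∫ κ, fderiv ℝ (N.logChan e) (d, κ) (1, 0) ∂(N.chanLaw e d) = 0 := by
  rw [h.integrable_chanLaw_iff, h.integral_chanLaw]
  simp only [h.chan_mul_score hd]
  exact h.integral_deriv hd

end Channel

end Network

/-! ### Geometry of the links -/

theorem norm_planar (p q : Pt) : ‖(⟨p 0 - q 0, p 1 - q 1⟩ : ℂ)‖ = ‖p - q‖ := by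
  rw [EuclideanSpace.norm_eq, Complex.norm_eq_sqrt_sq_add_sq]
  simp [Fin.sum_univ_two]

theorem unitVec_angle {p q : Pt} (h : 0 < ‖p - q‖) (a : Fin 2) :
    unitVec (angle p q) a = (p a - q a) / ‖p - q‖ := by
  have hz : (⟨p 0 - q 0, p 1 - q 1⟩ : ℂ) ≠ 0 := by
    rw [← norm_pos_iff, norm_planar]
    exact h
  fin_cases a
  · simp [unitVec, angle, Complex.cos_arg hz, norm_planar]
  · simp [unitVec, angle, Complex.sin_arg, norm_planar]

theorem rdm_apply (φ : ℝ) (a b : Fin 2) : rdm φ a b = unitVec φ a * unitVec φ b := by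
  fin_cases a <;> fin_cases b <;> simp [rdm, unitVec] <;> ring

/-- Exchanging the two ends reverses the unit vector, and `q qᵀ` is even in `q`. -/
theorem rdm_angle_comm (p q : Pt) : rdm (angle p q) = rdm (angle q p) := by
  rcases eq_or_ne p q with rfl | h
  · rfl
  · have h1 : 0 < ‖p - q‖ := norm_pos_iff.2 (sub_ne_zero.2 h)
    have h2 : 0 < ‖q - p‖ := norm_pos_iff.2 (sub_ne_zero.2 h.symm)
    ext a b
    rw [rdm_apply, rdm_apply, unitVec_angle h1, unitVec_angle h1, unitVec_angle h2,
      unitVec_angle h2, norm_sub_rev q p]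
    ring

namespace Network

variable {Na Nb : ℕ} {N : Network Na Nb}

/-- Sign with which the position of agent `k` enters the difference of the ends of `e`. -/
def incidence (e : Fin Na × Node Na Nb) (k : Fin Na) : ℝ :=
  (if e.1 = k then 1 else 0) - (if e.2 = Sum.inl k then 1 else 0)

theorem hasFDerivAt_nodePos (j : Node Na Nb) :
    ∃ A : Positions Na →L[ℝ] Pt, (∀ P, HasFDerivAt (fun P => N.nodePos P j) A P) ∧
      ∀ k v, A (Pi.single k v) = if j = Sum.inl k then v else 0 := by
  rcases j with i | b
  · refine ⟨ContinuousLinearMap.proj i, fun P => hasFDerivAt_apply i P, fun k v => ?_⟩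
    simp [Pi.single_apply]
  · exact ⟨0, fun P => hasFDerivAt_const _ _, by simp⟩

theorem contDiff_linkDiff (e : Fin Na × Node Na Nb) :
    ContDiff ℝ 2 (fun P : Positions Na => P e.1 - N.nodePos P e.2) := by
  have h : ContDiff ℝ 2 (fun P : Positions Na => N.nodePos P e.2) := by
    rcases e.2 with i | b
    · exact contDiff_apply ℝ Pt i
    · exact contDiff_const
  exact (contDiff_apply ℝ Pt e.1).sub h

theorem contDiffAt_linkDist (e : Fin Na × Node Na Nb) {P : Positions Na}
    (h : 0 < N.linkDist e P) : ContDiffAt ℝ 2 (N.linkDist e) P :=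
  (contDiff_linkDiff e).contDiffAt.norm ℝ (norm_pos_iff.1 h)

theorem continuous_linkDist (e : Fin Na × Node Na Nb) : Continuous (N.linkDist e) :=
  (contDiff_linkDiff e).continuous.norm

/-- Both sides of `d * d = ‖u‖²` are differentiated, where `u` is the difference of the ends, and
the result is divided by `d > 0`. -/
theorem fderiv_linkDist (e : Fin Na × Node Na Nb) {P : Positions Na} (h : 0 < N.linkDist e P)
    (x : PosIdx Na) : fderiv ℝ (N.linkDist e) P (posDir x) =
      incidence e x.1 * unitVec (N.linkAngle e P) x.2 := by
  obtain ⟨A, hA, hA'⟩ := hasFDerivAt_nodePos (N := N) e.2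
  have hu : HasFDerivAt (fun P : Positions Na => P e.1 - N.nodePos P e.2)
    (ContinuousLinearMap.proj e.1 - A) P := (hasFDerivAt_apply e.1 P).sub (hA P)
  have hsq := hu.norm_sq
  have hd : HasFDerivAt (N.linkDist e) (fderiv ℝ (N.linkDist e) P) P :=
    ((contDiffAt_linkDist e h).differentiableAt (by norm_num)).hasFDerivAt
  have heq := congrArg (fun A : Positions Na →L[ℝ] ℝ => A (posDir x))
    ((hd.mul hd).unique (by
      refine hsq.congr_of_eventuallyEq (Filter.Eventually.of_forall fun Q => ?_)
      simp [linkDist, sq]))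
  have hv : (ContinuousLinearMap.proj e.1 - A : Positions Na →L[ℝ] Pt) (posDir x) =
      incidence e x.1 • EuclideanSpace.single x.2 (1 : ℝ) := by
    rw [sub_apply, posDir, hA', incidence, sub_smul]
    congr 1
    · simp [Pi.single_apply]
    · split_ifs <;> simp
  have hl : linkDist N e P * fderiv ℝ (N.linkDist e) P (posDir x) =
      incidence e x.1 * (P e.1 x.2 - N.nodePos P e.2 x.2) := by
    simp only [add_apply, smul_apply, smul_eq_mul, ContinuousLinearMap.comp_apply, hv,
      innerSL_apply_apply, inner_smul_right, EuclideanSpace.inner_single_right] at heq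
    simp only [PiLp.sub_apply, map_sub, nsmul_eq_mul] at heq
    simp at heq
    linarith
  have hd0 : N.linkDist e P ≠ 0 := h.ne'
  rw [linkAngle, unitVec_angle h]
  change _ = incidence e x.1 * ((P e.1 x.2 - N.nodePos P e.2 x.2) / N.linkDist e P)
  field_simp
  linarith

/-- The ends coincide only on a proper subspace (two different agents) or on a set fixing one
agent's position (an anchor); both are null. So the singularity of the norm never matters under a
density. -/
theorem ae_linkDist_pos {e : Fin Na × Node Na Nb} (he : ∀ k, e ≠ (k, Sum.inl k)) :
    ∀ᵐ P : Positions Na, 0 < N.linkDist e P := by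
  obtain ⟨k, j⟩ := e
  have key : volume {P : Positions Na | P k = N.nodePos P j} = 0 := by
    rcases j with i | b
    · have hne : k ≠ i := fun h => he i (by rw [h])
      set S : Submodule ℝ (Positions Na) :=
        LinearMap.ker (LinearMap.proj (φ := fun _ : Fin Na => Pt) (R := ℝ) k -
          LinearMap.proj (φ := fun _ : Fin Na => Pt) (R := ℝ) i) with hS
      have hSt : S ≠ ⊤ := by
        intro h
        have hm : (Pi.single k (EuclideanSpace.single 0 1) : Positions Na) ∈ S := by
          rw [h]; trivial
        rw [hS, LinearMap.mem_ker] at hm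
        have := congrArg (fun v : Pt => v 0) hm
        simp [hne.symm] at this
      have := Measure.addHaar_submodule (volume : Measure (Positions Na)) S hSt
      convert this using 2
      ext P
      simp [hS, nodePos, sub_eq_zero]
    · exact Measure.pi_hyperplane (fun _ : Fin Na => (volume : Measure Pt)) k (N.anchor b)
  have : ∀ᵐ P : Positions Na, P ∉ {P : Positions Na | P k = N.nodePos P j} :=
    measure_eq_zero_iff_ae_notMem.1 key
  filter_upwards [this] with P hP
  exact norm_pos_iff.2 (sub_ne_zero.2 hP)

/-! ### Derivatives of functions of the parameters of one link -/

/-- The coordinate of `(d, κ)` of the link `e` that a coordinate of the parameter vector moves. -/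
def linkCoord (e : N.links) : PosIdx Na ⊕ N.ChanIdx → Unit ⊕ N.Coord e
  | .inl _ => .inl ()
  -- The default for a parameter of another link is harmless, since `linkRate` is zero there.
  | .inr i => if h : i.1 = e then .inr (h ▸ i.2) else .inl ()

/-- The rate at which a coordinate of the parameter vector moves the coordinate `linkCoord`. -/
def linkRate (e : N.links) (P : Positions Na) : PosIdx Na ⊕ N.ChanIdx → ℝ
  | .inl x => incidence e.1 x.1 * unitVec (N.linkAngle e P) x.2
  | .inr i => if i.1 = e then 1 else 0

/-- Projection of the parameter vector to the multipath parameters of one waveform. -/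
def chanProj (e : N.links) : N.Param →L[ℝ] (N.Coord e → ℝ) :=
  (ContinuousLinearMap.proj (R := ℝ) (φ := fun e : N.links => N.Coord e → ℝ) e).comp
    (ContinuousLinearMap.snd ℝ _ _)

theorem contDiffAt_linkParam (e : N.links) {θ : N.Param} (h : 0 < N.linkDist e θ.1) :
    ContDiffAt ℝ 2 (N.linkParam e) θ :=
  ((contDiffAt_linkDist e.1 h).comp θ contDiffAt_fst).prodMk
    (chanProj e).contDiff.contDiffAt

theorem fderiv_linkParam (e : N.links) {θ : N.Param} (h : 0 < N.linkDist e θ.1)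
    (v : N.Param) : fderiv ℝ (N.linkParam e) θ v =
      (fderiv ℝ (N.linkDist e) θ.1 v.1, v.2 e) := by
  have h1 : HasFDerivAt (fun θ : N.Param => N.linkDist e θ.1)
      ((fderiv ℝ (N.linkDist e) θ.1).comp (ContinuousLinearMap.fst ℝ _ _)) θ :=
    HasFDerivAt.comp (g := N.linkDist e) θ
      ((contDiffAt_linkDist e.1 h).differentiableAt (by norm_num)).hasFDerivAt hasFDerivAt_fst
  have h3 : HasFDerivAt (N.linkParam e) _ θ := h1.prodMk (chanProj e).hasFDerivAt
  rw [h3.fderiv]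
  rfl

theorem fderiv_linkParam_paramDir (e : N.links) {θ : N.Param} (h : 0 < N.linkDist e θ.1)
    (i : PosIdx Na ⊕ N.ChanIdx) : fderiv ℝ (N.linkParam e) θ (N.paramDir i) =
      linkRate e θ.1 i • N.linkDir e (linkCoord e i) := by
  rw [fderiv_linkParam e h]
  rcases i with x | ⟨e', i⟩
  · simp [paramDir, fderiv_linkDist e.1 h, linkRate, linkCoord, linkDir]
  · by_cases he : e' = e
    · subst he
      simp [paramDir, linkRate, linkCoord, linkDir]
    · simp [paramDir, linkRate, he, Ne.symm he]

/-- The `κ` component is linear in the parameter vector, so all curvature lies along the distance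
coordinate. -/
theorem d2_linkParam (e : N.links) {θ : N.Param} (h : 0 < N.linkDist e θ.1) (v w : N.Param) :
    d2 (N.linkParam e) θ v w = (d2 (N.linkDist e) θ.1 v.1 w.1) • ((1 : ℝ), (0 : N.Coord e → ℝ)) := by
  have hev : ∀ᶠ θ' in nhds θ, 0 < N.linkDist e θ'.1 :=
    ((continuous_linkDist e.1).comp continuous_fst).continuousAt.eventually (lt_mem_nhds h)
  have h1 : (fun θ' : N.Param => fderiv ℝ (N.linkParam e) θ' w) =ᶠ[nhds θ]
      fun θ' => (fderiv ℝ (N.linkDist e) θ'.1 w.1, w.2 e) := by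
    filter_upwards [hev] with θ' hθ'
    exact fderiv_linkParam e hθ' w
  have hd : DifferentiableAt ℝ (fun P => fderiv ℝ (N.linkDist e) P w.1) θ.1 :=
    (differentiableAt_fderiv (contDiffAt_linkDist e.1 h)).clm_apply (differentiableAt_const _)
  have h2 : HasFDerivAt (fun θ' : N.Param => fderiv ℝ (N.linkDist e) θ'.1 w.1)
      ((fderiv ℝ (fun P => fderiv ℝ (N.linkDist e) P w.1) θ.1).comp
        (ContinuousLinearMap.fst ℝ _ _)) θ :=
    HasFDerivAt.comp (g := fun P => fderiv ℝ (N.linkDist e) P w.1) θ hd.hasFDerivAt hasFDerivAt_fst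
  rw [d2, h1.fderiv_eq, (h2.prodMk (hasFDerivAt_const (w.2 e) θ)).fderiv]
  simp [d2]

/-- The decisive splitting: the first term becomes an entry of `Φ` after averaging, the second is a
multiple of the distance score and averages to zero. -/
theorem hess_comp_linkParam (e : N.links) {θ : N.Param} (h : 0 < N.linkDist e θ.1)
    {G : ℝ × (N.Coord e → ℝ) → ℝ} (hG : ContDiffAt ℝ 2 G (N.linkParam e θ))
    (i j : PosIdx Na ⊕ N.ChanIdx) :
    hess N.paramDir (fun θ => G (N.linkParam e θ)) θ i j =
      linkRate e θ.1 i * linkRate e θ.1 j *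
        hess (N.linkDir e) G (N.linkParam e θ) (linkCoord e i) (linkCoord e j) +
      d2 (N.linkDist e) θ.1 (N.paramDir i).1 (N.paramDir j).1 *
        fderiv ℝ G (N.linkParam e θ) (1, 0) := by
  rw [hess_eq_d2, d2_comp hG (contDiffAt_linkParam e h), d2_linkParam e h,
    fderiv_linkParam_paramDir e h, fderiv_linkParam_paramDir e h, d2_smul_smul hG, map_smul]
  rfl

/-! ### Expected information of one link, given the distance -/

section LinkInfo

variable {Ω : Type*} [MeasurableSpace Ω] {μ : Measure Ω} {B : N.links → ℝ≥0 → Ω → ℝ}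

theorem IsNoise.ae_continuous_prod [SFinite μ] {α : Type*} [MeasurableSpace α] {ν : Measure α}
    (hB : N.IsNoise B μ) : ∀ᵐ z : α × Ω ∂(ν.prod μ), ∀ e, Continuous (B e · z.2) :=
  Measure.quasiMeasurePreserving_snd.ae hB.ae_continuous

theorem ae_hess_waveLL [SFinite μ] (hB : N.IsNoise B μ) (e : N.links) (d : ℝ) (p q : Unit ⊕ N.Coord e) :
    (fun z : (N.Coord e → ℝ) × Ω =>
      hess (N.linkDir e) (N.waveLL e (d, z.1) (B e · z.2)) (d, z.1) p q) =ᵐ[(N.chanLaw e d).prod μ]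
    fun z => ∑ i, ∑ j, N.waveDir e p i / N.c * (N.waveDir e q j / N.c) *
        hess (fun i => Pi.single i (1 : ℝ))
          (fun x => Real.log (lik N.c N.N₀ N.T N.s (N.linkObs e (d, z.1) (B e · z.2)) x))
          (delayAmp N.c d z.1) i j := by
  filter_upwards [hB.ae_continuous_prod] with z hz
  exact hess_waveLL e.1 (d, z.1) (hz e) p q

theorem integrable_hess_waveLL [SFinite μ] (hB : N.IsNoise B μ) (hwave : N.WaveInfoExists B μ) (e : N.links)
    {d : ℝ} (hd : 0 < d) (p q : Unit ⊕ N.Coord e) :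
    Integrable (fun z : (N.Coord e → ℝ) × Ω =>
      hess (N.linkDir e) (N.waveLL e (d, z.1) (B e · z.2)) (d, z.1) p q)
      ((N.chanLaw e d).prod μ) := by
  refine Integrable.congr ?_ (ae_hess_waveLL hB e d p q).symm
  exact integrable_finsetSum _ fun i _ => integrable_finsetSum _ fun j _ =>
    (hwave e d hd i j).const_mul _

theorem integral_hess_waveLL [SFinite μ] (hB : N.IsNoise B μ) (hwave : N.WaveInfoExists B μ) (e : N.links)
    {d : ℝ} (hd : 0 < d) (p q : Unit ⊕ N.Coord e) :
    ∫ z : (N.Coord e → ℝ) × Ω, -hess (N.linkDir e) (N.waveLL e (d, z.1) (B e · z.2)) (d, z.1) p q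
      ∂((N.chanLaw e d).prod μ) =
    ∑ i, ∑ j, N.waveDir e p i / N.c * (N.waveDir e q j / N.c) * N.waveInfo B μ e d i j := by
  rw [integral_neg, integral_congr_ae (ae_hess_waveLL hB e d p q), integral_finsetSum _ fun i _ =>
    integrable_finsetSum _ fun j _ => (hwave e d hd i j).const_mul _, ← Finset.sum_neg_distrib]
  refine Finset.sum_congr rfl fun i _ => ?_
  rw [integral_finsetSum _ fun j _ => (hwave e d hd i j).const_mul _, ← Finset.sum_neg_distrib]
  refine Finset.sum_congr rfl fun j _ => ?_
  rw [integral_const_mul, waveInfo, Matrix.of_apply, integral_neg]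
  ring

theorem ae_pos_prod [SFinite μ] {e : N.links} (h : N.IsChannelPrior e) (d : ℝ) :
    ∀ᵐ z : (N.Coord e → ℝ) × Ω ∂((N.chanLaw e d).prod μ), 0 < N.chan e z.1 d :=
  Measure.quasiMeasurePreserving_fst.ae (h.ae_pos d)

/-- Almost surely the path is continuous and the density positive, so the Hessian of the sum splits.
The waveform part then transforms by `waveDir`, and the prior part does not involve the noise. -/
theorem linkInfo_eq [IsProbabilityMeasure μ] (hB : N.IsNoise B μ) (hwave : N.WaveInfoExists B μ) (e : N.links)
    (h : N.IsChannelPrior e) {d : ℝ} (hd : 0 < d) (p q : Unit ⊕ N.Coord e) :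
    Integrable (fun z : (N.Coord e → ℝ) × Ω =>
      hess (N.linkDir e) (N.waveLL e (d, z.1) (B e · z.2)) (d, z.1) p q +
        hess (N.linkDir e) (N.logChan e) (d, z.1) p q) ((N.chanLaw e d).prod μ) ∧
    ∫ z : (N.Coord e → ℝ) × Ω,
      -(hess (N.linkDir e) (N.waveLL e (d, z.1) (B e · z.2)) (d, z.1) p q +
        hess (N.linkDir e) (N.logChan e) (d, z.1) p q) ∂((N.chanLaw e d).prod μ) =
      N.linkInfo B μ e d p q ∧
    N.linkInfo B μ e d p q =
      ∑ i, ∑ j, N.waveDir e p i / N.c * (N.waveDir e q j / N.c) * N.waveInfo B μ e d i j +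
        N.chanInfo e d p q := by
  have := h.prob d hd
  have h1 := integrable_hess_waveLL hB hwave e hd p q
  have h2 : Integrable (fun z : (N.Coord e → ℝ) × Ω =>
      hess (N.linkDir e) (N.logChan e) (d, z.1) p q) ((N.chanLaw e d).prod μ) :=
    (h.integrable d hd p q).comp_fst μ
  have hlink : ∫ z : (N.Coord e → ℝ) × Ω,
      -(hess (N.linkDir e) (N.waveLL e (d, z.1) (B e · z.2)) (d, z.1) p q +
        hess (N.linkDir e) (N.logChan e) (d, z.1) p q) ∂((N.chanLaw e d).prod μ) =
      N.linkInfo B μ e d p q := by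
    rw [linkInfo, Matrix.of_apply]
    refine integral_congr_ae ?_
    filter_upwards [hB.ae_continuous_prod, ae_pos_prod h d] with z hz hz'
    simp only [hess_eq_d2]
    rw [← d2_add (contDiff_waveLL e.1 (d, z.1) (hz e)).contDiffAt (h.contDiffAt_log hd hz')]
    rfl
  refine ⟨h1.add h2, hlink, ?_⟩
  rw [← hlink]
  simp only [neg_add]
  rw [integral_add h1.fun_neg h2.fun_neg, integral_hess_waveLL hB hwave e hd]
  congr 1
  have := integral_fun_fst (μ := N.chanLaw e d) (ν := μ)
    fun κ => -hess (N.linkDir e) (N.logChan e) (d, κ) p q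
  rw [this, probReal_univ, one_smul]
  rfl

end LinkInfo

end Network

/-! ### Products of densities -/

/-- A product measure is determined by its values on boxes, where the integral of the product
density factorizes. -/
theorem withDensity_fun_prod {ι : Type*} [Fintype ι] {X : ι → Type*} [∀ i, MeasureSpace (X i)]
    [∀ i, SigmaFinite (volume : Measure (X i))] {g : ∀ i, X i → ℝ} (h0 : ∀ i x, 0 ≤ g i x)
    (hi : ∀ i, Integrable (g i)) :
    Measure.pi (fun i => (volume : Measure (X i)).withDensity fun x => ENNReal.ofReal (g i x)) =
      (volume : Measure (∀ i, X i)).withDensity fun x => ENNReal.ofReal (∏ i, g i (x i)) := by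
  refine Measure.pi_eq fun s hs => ?_
  rw [withDensity_apply _ (MeasurableSet.univ_pi hs)]
  have h1 : (volume : Measure (∀ i, X i)).restrict (Set.univ.pi s) =
      Measure.pi fun i => (volume : Measure (X i)).restrict (s i) :=
    Measure.restrict_pi_pi _ _
  have h2 : ∀ i, Integrable (g i) ((volume : Measure (X i)).restrict (s i)) :=
    fun i => (hi i).integrableOn
  rw [h1, ← ofReal_integral_eq_lintegral_ofReal (Integrable.fintype_prod_dep h2)
    (Filter.Eventually.of_forall fun x => Finset.prod_nonneg fun i _ => h0 i _),
    integral_fintype_prod_eq_prod, ENNReal.ofReal_prod_of_nonneg fun i _ => integral_nonneg (h0 i)]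
  refine Finset.prod_congr rfl fun i _ => ?_
  rw [withDensity_apply _ (hs i), ofReal_integral_eq_lintegral_ofReal (h2 i)
    (Filter.Eventually.of_forall (h0 i))]

theorem integrable_withDensity_ofReal_iff {α : Type*} [MeasurableSpace α] {μ : Measure α}
    {ρ : α → ℝ} (hρ : Measurable ρ) (h0 : ∀ x, 0 ≤ ρ x) (g : α → ℝ) :
    Integrable g (μ.withDensity fun x => ENNReal.ofReal (ρ x)) ↔
      Integrable (fun x => ρ x * g x) μ := by
  rw [integrable_withDensity_iff_integrable_smul' hρ.ennreal_ofReal (by simp)]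
  refine integrable_congr (Filter.Eventually.of_forall fun x => ?_)
  simp [ENNReal.toReal_ofReal (h0 x)]

theorem integral_withDensity_ofReal {α : Type*} [MeasurableSpace α] {μ : Measure α}
    {ρ : α → ℝ} (hρ : Measurable ρ) (h0 : ∀ x, 0 ≤ ρ x) (g : α → ℝ) :
    ∫ x, g x ∂(μ.withDensity fun x => ENNReal.ofReal (ρ x)) = ∫ x, ρ x * g x ∂μ := by
  rw [integral_withDensity_eq_integral_toReal_smul hρ.ennreal_ofReal (by simp)]
  refine integral_congr_ae (Filter.Eventually.of_forall fun x => ?_)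
  simp [ENNReal.toReal_ofReal (h0 x)]

namespace Network

variable {Na Nb : ℕ} {N : Network Na Nb} {Ω : Type*} [MeasurableSpace Ω] {μ : Measure Ω}
  {B : N.links → ℝ≥0 → Ω → ℝ} {Pbar : Positions Na} {f : Positions Na → ℝ}

/-! ### The joint prior law given the positions -/

/-- The density is continuous on the open set where it is positive and zero elsewhere. -/
theorem IsPositionPrior.measurable (hf : N.IsPositionPrior B μ Pbar f) : Measurable f := by
  classical
  have h : f = Set.piecewise {P | 0 < f P} f fun _ => 0 := by
    funext P
    by_cases hP : 0 < f P
    · simp [Set.piecewise, hP]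
    · simp only [Set.piecewise, Set.mem_ofPred_eq, hP, if_false]
      exact le_antisymm (not_lt.1 hP) (hf.nonneg P)
  rw [h]
  exact hf.smooth.continuousOn.measurable_piecewise continuousOn_const hf.isOpen_pos.measurableSet

theorem IsPositionPrior.ae_pos (hf : N.IsPositionPrior B μ Pbar f) :
    ∀ᵐ P ∂(posLaw f), 0 < f P := by
  rw [posLaw, ae_withDensity_iff hf.measurable.ennreal_ofReal]
  exact Filter.Eventually.of_forall fun P hP => by simpa using hP

theorem IsPositionPrior.ae_linkDist (_hf : N.IsPositionPrior B μ Pbar f) :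
    ∀ᵐ P ∂(posLaw f), ∀ e : N.links, 0 < N.linkDist e P := by
  refine ae_all_iff.2 fun e => ?_
  refine (withDensity_absolutelyContinuous _ _).ae_le (ae_linkDist_pos fun k h => ?_)
  have := e.2
  rw [h] at this
  exact N.no_self k this

/-- Product of the channel priors at given positions. -/
def chanProd (N : Network Na Nb) (P : Positions Na) (κ : ∀ e : N.links, N.Coord e → ℝ) : ℝ :=
  ∏ e : N.links, N.chan e (κ e) (N.linkDist e P)

/-- Conditional law of all multipath parameters given the positions. -/
def condLaw (N : Network Na Nb) (P : Positions Na) : Measure (∀ e : N.links, N.Coord e → ℝ) :=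
  Measure.pi fun e : N.links => N.chanLaw e (N.linkDist e P)

theorem condLaw_eq (hchan : ∀ e : N.links, N.IsChannelPrior e) {P : Positions Na}
    (hP : ∀ e : N.links, 0 < N.linkDist e P) :
    N.condLaw P = volume.withDensity fun κ => ENNReal.ofReal (N.chanProd P κ) :=
  withDensity_fun_prod (g := fun (e : N.links) κ => N.chan e κ (N.linkDist e P))
    (fun e κ => (hchan e).nonneg κ _) fun e => (hchan e).integrable_chan (hP e)

theorem chanProd_nonneg (hchan : ∀ e : N.links, N.IsChannelPrior e) (P : Positions Na)
    (κ : ∀ e : N.links, N.Coord e → ℝ) : 0 ≤ N.chanProd P κ :=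
  Finset.prod_nonneg fun e _ => (hchan e).nonneg _ _

theorem measurable_chanProd (hchan : ∀ e : N.links, N.IsChannelPrior e) :
    Measurable fun θ : N.Param => N.chanProd θ.1 θ.2 := by
  refine Finset.measurable_fun_prod _ fun e _ => ?_
  have h1 : Measurable fun θ : N.Param => θ.2 e := (measurable_pi_apply e).comp measurable_snd
  have h2 : Measurable fun θ : N.Param => N.linkDist e θ.1 :=
    (continuous_linkDist e.1).measurable.comp measurable_fst
  exact (hchan e).meas.comp (h1.prodMk h2)

theorem measurable_priorDensity (hchan : ∀ e : N.links, N.IsChannelPrior e)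
    (hf : N.IsPositionPrior B μ Pbar f) : Measurable (N.priorDensity f) :=
  (hf.measurable.comp measurable_fst).mul (measurable_chanProd hchan)

theorem priorDensity_nonneg (hchan : ∀ e : N.links, N.IsChannelPrior e)
    (hf : N.IsPositionPrior B μ Pbar f) (θ : N.Param) : 0 ≤ N.priorDensity f θ :=
  mul_nonneg (hf.nonneg _) (chanProd_nonneg hchan _ _)

/-- Fubini's theorem for the law of the parameters and the noise, conditionally on the positions. -/
theorem integral_priorLaw_prod [SFinite μ] (hchan : ∀ e : N.links, N.IsChannelPrior e)
    (hf : N.IsPositionPrior B μ Pbar f) {h : N.Param × Ω → ℝ}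
    (hi : Integrable h ((N.priorLaw f).prod μ)) :
    (∀ᵐ P ∂(posLaw f), Integrable (fun z : (∀ e : N.links, N.Coord e → ℝ) × Ω =>
      h ((P, z.1), z.2)) ((N.condLaw P).prod μ)) ∧
    ∫ z, h z ∂((N.priorLaw f).prod μ) =
      ∫ P, ∫ z : (∀ e : N.links, N.Coord e → ℝ) × Ω, h ((P, z.1), z.2) ∂((N.condLaw P).prod μ)
        ∂(posLaw f) := by
  have hm := measurable_priorDensity hchan hf
  have hm1 : Measurable fun z : N.Param × Ω => N.priorDensity f z.1 := hm.comp measurable_fst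
  have hprior : (N.priorLaw f).prod μ = ((volume : Measure N.Param).prod μ).withDensity
      fun z => ENNReal.ofReal (N.priorDensity f z.1) := prod_withDensity_left hm.ennreal_ofReal
  have hcond : ∀ P : Positions Na, (∀ e : N.links, 0 < N.linkDist e P) → (N.condLaw P).prod μ =
      ((volume : Measure (∀ e : N.links, N.Coord e → ℝ)).prod μ).withDensity
        fun z => ENNReal.ofReal (N.chanProd P z.1) := fun P hP => by
    rw [condLaw_eq hchan hP]
    exact prod_withDensity_left
      ((measurable_chanProd hchan).comp (measurable_const.prodMk measurable_id)).ennreal_ofReal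
  have hcm : ∀ P : Positions Na, Measurable
      fun z : (∀ e : N.links, N.Coord e → ℝ) × Ω => N.chanProd P z.1 := fun P =>
    (measurable_chanProd hchan).comp (measurable_const.prodMk measurable_fst)
  have hassoc := measurePreserving_prodAssoc (volume : Measure (Positions Na))
    (volume : Measure (∀ e : N.links, N.Coord e → ℝ)) μ
  -- The density is moved into the integrand and the variables are regrouped, so that the positions
  -- become the outer variable.
  set k : Positions Na × ((∀ e : N.links, N.Coord e → ℝ) × Ω) → ℝ :=
    fun w => N.priorDensity f (w.1, w.2.1) * h ((w.1, w.2.1), w.2.2) with hk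
  have hki : Integrable k ((volume : Measure (Positions Na)).prod
      ((volume : Measure (∀ e : N.links, N.Coord e → ℝ)).prod μ)) := by
    rw [hprior, integrable_withDensity_ofReal_iff hm1
      (fun z => priorDensity_nonneg hchan hf z.1)] at hi
    rw [← hassoc.integrable_comp_emb MeasurableEquiv.prodAssoc.measurableEmbedding]
    exact hi
  have hkP : ∀ P, (fun z : (∀ e : N.links, N.Coord e → ℝ) × Ω => k (P, z)) =
      fun z => f P * (N.chanProd P z.1 * h ((P, z.1), z.2)) := fun P => by
    funext z
    simp only [hk, priorDensity, chanProd, mul_assoc]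
  refine ⟨?_, ?_⟩
  · have h1 : ∀ᵐ P ∂(posLaw f), Integrable
        (fun z : (∀ e : N.links, N.Coord e → ℝ) × Ω => k (P, z))
        ((volume : Measure (∀ e : N.links, N.Coord e → ℝ)).prod μ) :=
      (withDensity_absolutelyContinuous _ _).ae_le hki.prod_right_ae
    filter_upwards [h1, hf.ae_pos, hf.ae_linkDist] with P hP hP0 hPd
    -- The factor `f P` is constant on the slice and almost surely positive, so it can be cancelled.
    rw [hkP, integrable_const_mul_iff (IsUnit.mk0 _ hP0.ne')] at hP
    rw [hcond P hPd, integrable_withDensity_ofReal_iff (hcm P)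
      (fun z => chanProd_nonneg hchan P z.1)]
    exact hP
  · rw [hprior, integral_withDensity_ofReal hm1
      (fun z => priorDensity_nonneg hchan hf z.1)]
    have h2 : ∫ z, k z ∂((volume : Measure (Positions Na)).prod
        ((volume : Measure (∀ e : N.links, N.Coord e → ℝ)).prod μ)) =
        ∫ x, N.priorDensity f x.1 * h x ∂((volume : Measure N.Param).prod μ) :=
      (hassoc.integral_comp' (f := MeasurableEquiv.prodAssoc) k).symm
    rw [← h2, integral_prod _ hki]
    have h3 : ∫ P, (∫ z : (∀ e : N.links, N.Coord e → ℝ) × Ω, h ((P, z.1), z.2)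
        ∂((N.condLaw P).prod μ)) ∂(posLaw f) =
        ∫ P, (∫ z : (∀ e : N.links, N.Coord e → ℝ) × Ω, N.chanProd P z.1 * h ((P, z.1), z.2)
        ∂((volume : Measure (∀ e : N.links, N.Coord e → ℝ)).prod μ)) ∂(posLaw f) := by
      refine integral_congr_ae ?_
      filter_upwards [hf.ae_linkDist] with P hPd
      rw [hcond P hPd, integral_withDensity_ofReal (hcm P)
        (fun z => chanProd_nonneg hchan P z.1)]
    rw [h3, posLaw, integral_withDensity_ofReal hf.measurable hf.nonneg]
    refine integral_congr_ae (Filter.Eventually.of_forall fun P => ?_)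
    simp only
    rw [hkP, integral_const_mul]

theorem isProbabilityMeasure_condLaw (hchan : ∀ e : N.links, N.IsChannelPrior e)
    {P : Positions Na} (hP : ∀ e : N.links, 0 < N.linkDist e P) :
    IsProbabilityMeasure (N.condLaw P) := by
  have := fun e : N.links => (hchan e).prob _ (hP e)
  exact Measure.pi.instIsProbabilityMeasure _

/-- For almost every `P` all distances are positive, so the product of the channel priors has mass
one and integrates out. -/
theorem measurePreserving_fst_priorLaw (hchan : ∀ e : N.links, N.IsChannelPrior e)
    (hf : N.IsPositionPrior B μ Pbar f) :
    MeasurePreserving (Prod.fst : N.Param → Positions Na) (N.priorLaw f) (posLaw f) := by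
  refine ⟨measurable_fst, ?_⟩
  ext s hs
  rw [Measure.map_apply measurable_fst hs, priorLaw, withDensity_apply _ (measurable_fst hs),
    ← lintegral_indicator (measurable_fst hs)]
  have hm := (measurable_priorDensity hchan hf).ennreal_ofReal
  rw [show (volume : Measure N.Param) = (volume : Measure (Positions Na)).prod volume from rfl,
    lintegral_prod _ (hm.indicator (measurable_fst hs)).aemeasurable, posLaw,
    withDensity_apply _ hs, ← lintegral_indicator hs]
  refine lintegral_congr_ae ?_
  have hd : ∀ᵐ P : Positions Na, ∀ e : N.links, 0 < N.linkDist e P :=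
    ae_all_iff.2 fun e => ae_linkDist_pos fun k h => by
      have := e.2
      rw [h] at this
      exact N.no_self k this
  filter_upwards [hd] with P hP
  by_cases hPs : P ∈ s
  · have h1 := (isProbabilityMeasure_condLaw hchan hP).measure_univ
    rw [condLaw_eq hchan hP, withDensity_apply _ MeasurableSet.univ, Measure.restrict_univ] at h1
    have h2 : ∀ κ : (∀ e : N.links, N.Coord e → ℝ),
        ((Prod.fst : N.Param → _) ⁻¹' s).indicator (fun θ => ENNReal.ofReal (N.priorDensity f θ))
          (P, κ) = ENNReal.ofReal (f P) * ENNReal.ofReal (N.chanProd P κ) := fun κ => by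
      rw [Set.indicator_of_mem (by exact hPs), ← ENNReal.ofReal_mul (hf.nonneg P)]
      rfl
    simp only [h2]
    rw [lintegral_const_mul' _ _ (by simp), h1, mul_one, Set.indicator_of_mem hPs]
  · have h2 : ∀ κ : (∀ e : N.links, N.Coord e → ℝ),
        ((Prod.fst : N.Param → _) ⁻¹' s).indicator (fun θ => ENNReal.ofReal (N.priorDensity f θ))
          (P, κ) = 0 := fun κ => Set.indicator_of_notMem (by exact hPs) _
    simp [h2, Set.indicator_of_notMem hPs]

end Network

namespace Network

variable {Na Nb : ℕ} {N : Network Na Nb} {Ω : Type*} [MeasurableSpace Ω] {μ : Measure Ω}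
  {B : N.links → ℝ≥0 → Ω → ℝ} {Pbar : Positions Na} {f : Positions Na → ℝ}

/-! ### The Fisher information matrix -/

theorem ae_priorLaw_regular (hchan : ∀ e : N.links, N.IsChannelPrior e)
    (hf : N.IsPositionPrior B μ Pbar f) : ∀ᵐ θ ∂(N.priorLaw f), 0 < f θ.1 ∧
      ∀ e : N.links, 0 < N.linkDist e θ.1 ∧ 0 < N.chan e (θ.2 e) (N.linkDist e θ.1) := by
  have h1 : ∀ᵐ θ ∂(N.priorLaw f), N.priorDensity f θ ≠ 0 := by
    rw [priorLaw, ae_withDensity_iff (measurable_priorDensity hchan hf).ennreal_ofReal]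
    refine Filter.Eventually.of_forall fun θ hθ h0 => hθ ?_
    rw [h0, ENNReal.ofReal_zero]
  have h2 := (measurePreserving_fst_priorLaw hchan hf).quasiMeasurePreserving.ae hf.ae_linkDist
  filter_upwards [h1, h2] with θ hθ hd
  rw [priorDensity] at hθ
  refine ⟨lt_of_le_of_ne (hf.nonneg _) (left_ne_zero_of_mul hθ).symm, fun e => ⟨hd e, ?_⟩⟩
  exact lt_of_le_of_ne ((hchan e).nonneg _ _)
    (Finset.prod_ne_zero_iff.1 (right_ne_zero_of_mul hθ) e (Finset.mem_univ e)).symm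

/-- Second derivatives, in the parameter vector, of the log-likelihood of one waveform. -/
def waveHess (N : Network Na Nb) (B : N.links → ℝ≥0 → Ω → ℝ) (e : N.links)
    (i j : PosIdx Na ⊕ N.ChanIdx) (z : N.Param × Ω) : ℝ :=
  hess N.paramDir (fun θ => N.waveLL e (N.linkParam e z.1) (B e · z.2) (N.linkParam e θ)) z.1 i j

/-- Second derivatives, in the parameter vector, of the logarithm of one channel prior. -/
def chanHess (N : Network Na Nb) (e : N.links) (i j : PosIdx Na ⊕ N.ChanIdx) (θ : N.Param) : ℝ :=
  hess N.paramDir (fun θ => N.logChan e (N.linkParam e θ)) θ i j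

/-- Second derivatives, in the parameter vector, of the logarithm of the density of the
positions. -/
def posHess (N : Network Na Nb) (f : Positions Na → ℝ) :
    PosIdx Na ⊕ N.ChanIdx → PosIdx Na ⊕ N.ChanIdx → Positions Na → ℝ
  | .inl x, .inl y, P => hess posDir (fun Q => Real.log (f Q)) P x y
  | _, _, _ => 0

theorem d2_comp_fst {g : Positions Na → ℝ} {θ : N.Param} (hg : ContDiffAt ℝ 2 g θ.1)
    (v w : N.Param) : d2 (fun θ : N.Param => g θ.1) θ v w = d2 g θ.1 v.1 w.1 := by
  have hz : d2 (fun θ : N.Param => θ.1) θ v w = 0 := by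
    have : (fun y : N.Param => fderiv ℝ (fun θ : N.Param => θ.1) y w) = fun _ => w.1 := by
      funext y
      rw [fderiv_fst]
      rfl
    rw [d2, this]
    simp
  rw [d2_comp hg contDiffAt_fst, hz, map_zero, add_zero, fderiv_fst]
  rfl

theorem d2_logPrior {θ : N.Param} (hg : ContDiffAt ℝ 2 (fun Q => Real.log (f Q)) θ.1)
    (i j : PosIdx Na ⊕ N.ChanIdx) :
    d2 (fun θ : N.Param => Real.log (f θ.1)) θ (N.paramDir i) (N.paramDir j) =
      N.posHess f i j θ.1 := by
  rw [d2_comp_fst (g := fun Q => Real.log (f Q)) hg, d2_eq hg]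
  rcases i with x | x <;> rcases j with y | y
  · rw [posHess, hess_eq_d2, d2_eq hg]
    rfl
  all_goals simp [posHess, paramDir]

theorem IsPositionPrior.contDiffAt_log (hf : N.IsPositionPrior B μ Pbar f) {P : Positions Na}
    (hP : 0 < f P) : ContDiffAt ℝ 2 (fun Q => Real.log (f Q)) P :=
  (hf.smooth.contDiffAt (hf.isOpen_pos.mem_nhds hP)).log hP.ne'

/-- The positivity sets are open, so near a regular point the logarithm of the product is a sum of
`C²` terms. The observation stays frozen at the true `θ` while the argument `θ'` is differentiated.
-/
theorem hess_jointDensity (hchan : ∀ e : N.links, N.IsChannelPrior e)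
    (hf : N.IsPositionPrior B μ Pbar f) {θ : N.Param} {ω : Ω} (h0 : 0 < f θ.1)
    (h1 : ∀ e : N.links, 0 < N.linkDist e θ.1 ∧ 0 < N.chan e (θ.2 e) (N.linkDist e θ.1))
    (hω : ∀ e, Continuous (B e · ω)) (i j : PosIdx Na ⊕ N.ChanIdx) :
    hess N.paramDir (fun θ' => Real.log (N.jointDensity f (N.obs B θ ω) θ')) θ i j =
      N.posHess f i j θ.1 + ∑ e : N.links, (N.waveHess B e i j (θ, ω) + N.chanHess e i j θ) := by
  have hlp : ∀ e : N.links, ContDiffAt ℝ 2 (N.linkParam e) θ :=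
    fun e => contDiffAt_linkParam e (h1 e).1
  have hc : ∀ e : N.links, ContDiffAt ℝ 2 (fun θ => N.logChan e (N.linkParam e θ)) θ := fun e =>
    ContDiffAt.comp (g := N.logChan e) θ ((hchan e).contDiffAt_log (h1 e).1 (h1 e).2) (hlp e)
  have hw : ∀ e : N.links, ContDiffAt ℝ 2
      (fun θ' => N.waveLL e (N.linkParam e θ) (B e · ω) (N.linkParam e θ')) θ := fun e =>
    ContDiffAt.comp (g := N.waveLL e (N.linkParam e θ) (B e · ω)) θ
      (contDiff_waveLL e.1 (N.linkParam e θ) (hω e)).contDiffAt (hlp e)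
  have hp : ContDiffAt ℝ 2 (fun θ' : N.Param => Real.log (f θ'.1)) θ :=
    ContDiffAt.comp (g := fun Q => Real.log (f Q)) θ (hf.contDiffAt_log h0) contDiffAt_fst
  have hev : (fun θ' => Real.log (N.jointDensity f (N.obs B θ ω) θ')) =ᶠ[nhds θ] fun θ' =>
      Real.log (f θ'.1) + ∑ e : N.links, (N.waveLL e (N.linkParam e θ) (B e · ω) (N.linkParam e θ') +
        N.logChan e (N.linkParam e θ')) := by
    have e1 : ∀ᶠ θ' : N.Param in nhds θ, 0 < f θ'.1 :=
      continuous_fst.continuousAt.eventually (hf.isOpen_pos.mem_nhds h0)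
    have e2 : ∀ᶠ θ' : N.Param in nhds θ, ∀ e : N.links,
        0 < N.linkDist e θ'.1 ∧ 0 < N.chan e (θ'.2 e) (N.linkDist e θ'.1) := by
      rw [Filter.eventually_all]
      intro e
      exact (hlp e).continuousAt.eventually ((hchan e).isOpen_pos.mem_nhds (h1 e))
    filter_upwards [e1, e2] with θ' hf' hc'
    have hl : ∀ e : N.links, N.linkLik e (N.obs B θ ω e) (N.linkParam e θ') ≠ 0 := fun e => by
      simp [linkLik, lik]
    have hcn : ∀ e : N.links, N.chan e (θ'.2 e) (N.linkDist e θ'.1) ≠ 0 := fun e => (hc' e).2.ne'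
    rw [jointDensity, priorDensity, Real.log_mul (Finset.prod_ne_zero_iff.2 fun e _ => hl e)
      (mul_ne_zero hf'.ne' (Finset.prod_ne_zero_iff.2 fun e _ => hcn e)),
      Real.log_mul hf'.ne' (Finset.prod_ne_zero_iff.2 fun e _ => hcn e),
      Real.log_prod fun e _ => hl e, Real.log_prod fun e _ => hcn e,
      Finset.sum_add_distrib]
    simp only [waveLL, logChan, obs, linkParam]
    ring
  rw [hess_eq_d2, d2_congr hev, d2_add hp (ContDiffAt.sum fun e _ => (hw e).add (hc e)),
    d2_sum _ fun e _ => (hw e).add (hc e), d2_logPrior (hf.contDiffAt_log h0)]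
  congr 1
  refine Finset.sum_congr rfl fun e _ => ?_
  rw [d2_add (hw e) (hc e)]
  rfl

variable [IsProbabilityMeasure μ]

/-- Expected information of one link in the parameter vector. -/
theorem integral_linkHess (hB : N.IsNoise B μ) (hchan : ∀ e : N.links, N.IsChannelPrior e)
    (hwave : N.WaveInfoExists B μ) (hf : N.IsPositionPrior B μ Pbar f) (e : N.links)
    (i j : PosIdx Na ⊕ N.ChanIdx) :
    Integrable (fun z => -(N.waveHess B e i j z + N.chanHess e i j z.1))
      ((N.priorLaw f).prod μ) ∧
    ∫ z, -(N.waveHess B e i j z + N.chanHess e i j z.1) ∂((N.priorLaw f).prod μ) =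
      ∫ P, linkRate e P i * linkRate e P j *
        N.linkInfo B μ e (N.linkDist e P) (linkCoord e i) (linkCoord e j) ∂(posLaw f) := by
  have hi : Integrable (fun z => -(N.waveHess B e i j z + N.chanHess e i j z.1))
      ((N.priorLaw f).prod μ) :=
    ((hf.integrable_wave e i j).add ((hf.integrable_chan e i j).comp_fst μ)).neg
  refine ⟨hi, ?_⟩
  obtain ⟨h1, h2⟩ := integral_priorLaw_prod hchan hf hi
  rw [h2]
  refine integral_congr_ae ?_
  filter_upwards [h1, hf.ae_linkDist] with P hP hd
  have := isProbabilityMeasure_condLaw hchan hd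
  have hpr : ∀ e : N.links, IsProbabilityMeasure (N.chanLaw e (N.linkDist e P)) :=
    fun e => (hchan e).prob _ (hd e)
  have hev : MeasurePreserving (fun κ : ∀ e : N.links, N.Coord e → ℝ => κ e) (N.condLaw P)
      (N.chanLaw e (N.linkDist e P)) := measurePreserving_eval _ e
  have hevμ : MeasurePreserving
      (Prod.map (fun κ : ∀ e : N.links, N.Coord e → ℝ => κ e) (id : Ω → Ω))
      ((N.condLaw P).prod μ) ((N.chanLaw e (N.linkDist e P)).prod μ) :=
    hev.prod (MeasurePreserving.id μ)
  set d := N.linkDist e P with hd'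
  set p := linkCoord e i
  set q := linkCoord e j
  set r : ℝ := linkRate e P i * linkRate e P j
  set D : ℝ := d2 (N.linkDist e) P (N.paramDir i).1 (N.paramDir j).1
  set M : (N.Coord e → ℝ) × Ω → ℝ := fun z =>
    hess (N.linkDir e) (N.waveLL e (d, z.1) (B e · z.2)) (d, z.1) p q +
      hess (N.linkDir e) (N.logChan e) (d, z.1) p q with hM
  set S : (N.Coord e → ℝ) × Ω → ℝ := fun z =>
    fderiv ℝ (N.waveLL e (d, z.1) (B e · z.2)) (d, z.1) (1, 0) +
      fderiv ℝ (N.logChan e) (d, z.1) (1, 0) with hS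
  obtain ⟨hMi, hMint, -⟩ := linkInfo_eq hB hwave e (hchan e) (hd e) p q
  have hMi' : Integrable (fun z : (∀ e : N.links, N.Coord e → ℝ) × Ω => -M (z.1 e, z.2))
      ((N.condLaw P).prod μ) := (hevμ.integrable_comp_of_integrable hMi).neg
  have hae : (fun z : (∀ e : N.links, N.Coord e → ℝ) × Ω =>
      -(N.waveHess B e i j ((P, z.1), z.2) + N.chanHess e i j (P, z.1))) =ᵐ[(N.condLaw P).prod μ]
      fun z => r * -M (z.1 e, z.2) + -D * S (z.1 e, z.2) := by
    have hpos : ∀ᵐ z : (∀ e : N.links, N.Coord e → ℝ) × Ω ∂((N.condLaw P).prod μ),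
        0 < N.chan e (z.1 e) d :=
      Measure.quasiMeasurePreserving_fst.ae
        (hev.quasiMeasurePreserving.ae ((hchan e).ae_pos d))
    filter_upwards [hpos, hB.ae_continuous_prod] with z hz hzω
    rw [waveHess, chanHess, hess_comp_linkParam e (θ := (P, z.1)) (hd e)
        (contDiff_waveLL e.1 _ (hzω e)).contDiffAt,
      hess_comp_linkParam e (θ := (P, z.1)) (hd e) ((hchan e).contDiffAt_log (hd e) hz)]
    simp only [linkParam, hM, hS]
    ring
  -- Integrability of the score term is obtained by subtraction: the whole slice is integrable by
  -- Fubini, and the `Φ` part is integrable on its own.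
  have hSi : Integrable (fun z : (∀ e : N.links, N.Coord e → ℝ) × Ω => -D * S (z.1 e, z.2))
      ((N.condLaw P).prod μ) := by
    refine ((hP.congr hae).sub (hMi'.const_mul r)).congr (Filter.Eventually.of_forall fun z => ?_)
    simp
  -- The noise is integrated first, which removes the waveform score for each fixed `κ`; integration
  -- over `κ` then removes the prior score.
  have hS0 : ∫ z : (∀ e : N.links, N.Coord e → ℝ) × Ω, -D * S (z.1 e, z.2)
      ∂((N.condLaw P).prod μ) = 0 := by
    rw [integral_prod _ hSi]
    have hin : ∀ κ : (∀ e : N.links, N.Coord e → ℝ), ∫ ω, -D * S (κ e, ω) ∂μ =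
        -D * fderiv ℝ (N.logChan e) (d, κ e) (1, 0) := fun κ => by
      obtain ⟨a1, a2⟩ := hB.score e (d, κ e) (1, 0)
      simp only [hS]
      rw [integral_const_mul, integral_add a1 (integrable_const _), a2]
      simp
    simp only [hin]
    obtain ⟨b1, b2⟩ := (hchan e).score (hd e)
    rw [integral_const_mul]
    have := integral_comp_eval (μ := fun e : N.links => N.chanLaw e (N.linkDist e P)) (i := e)
      (f := fun κ => fderiv ℝ (N.logChan e) (d, κ) (1, 0)) b1.aestronglyMeasurable
    rw [condLaw, this, b2, mul_zero]
  have hMv : ∫ z : (∀ e : N.links, N.Coord e → ℝ) × Ω, -M (z.1 e, z.2) ∂((N.condLaw P).prod μ) =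
      N.linkInfo B μ e d p q := by
    rw [← hMint, ← hevμ.map_eq, integral_map hevμ.measurable.aemeasurable]
    · rfl
    · rw [hevμ.map_eq]
      exact hMi.neg.aestronglyMeasurable
  rw [integral_congr_ae hae, integral_add (hMi'.const_mul r) hSi, hS0, integral_const_mul, hMv,
    add_zero]

/-- The prior term depends on the positions alone, and each link contributes its conditional
expectation, so the Fisher matrix becomes a matrix of position averages. -/
theorem fim_apply (hB : N.IsNoise B μ) (hchan : ∀ e : N.links, N.IsChannelPrior e)
    (hwave : N.WaveInfoExists B μ) (hf : N.IsPositionPrior B μ Pbar f)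
    (i j : PosIdx Na ⊕ N.ChanIdx) :
    N.fim B μ f i j = (∫ P, -N.posHess f i j P ∂(posLaw f)) +
      ∑ e : N.links, ∫ P, linkRate e P i * linkRate e P j *
        N.linkInfo B μ e (N.linkDist e P) (linkCoord e i) (linkCoord e j) ∂(posLaw f) := by
  have hfst : MeasurePreserving (Prod.fst : N.Param × Ω → N.Param) ((N.priorLaw f).prod μ)
    (N.priorLaw f) := measurePreserving_fst
  have hmp : MeasurePreserving (fun z : N.Param × Ω => z.1.1) ((N.priorLaw f).prod μ)
    (posLaw f) := (measurePreserving_fst_priorLaw hchan hf).comp hfst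
  have hpi : Integrable (fun P => -N.posHess f i j P) (posLaw f) := by
    rcases i with x | x <;> rcases j with y | y
    · exact (hf.integrable_pos x y).neg
    all_goals simp [posHess]
  have hpi' : Integrable (fun z : N.Param × Ω => -N.posHess f i j z.1.1)
    ((N.priorLaw f).prod μ) := hmp.integrable_comp_of_integrable hpi
  have hae : (fun z : N.Param × Ω => -hess N.paramDir
      (fun θ => Real.log (N.jointDensity f (N.obs B z.1 z.2) θ)) z.1 i j)
      =ᵐ[(N.priorLaw f).prod μ] fun z => -N.posHess f i j z.1.1 +
        ∑ e : N.links, -(N.waveHess B e i j z + N.chanHess e i j z.1) := by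
    filter_upwards [hfst.quasiMeasurePreserving.ae (ae_priorLaw_regular hchan hf),
      hB.ae_continuous_prod] with z hz hzω
    rw [hess_jointDensity hchan hf hz.1 hz.2 hzω, neg_add, Finset.sum_neg_distrib]
  rw [fim, Matrix.of_apply, integral_congr_ae hae, integral_add hpi'
    (integrable_finsetSum _ fun e _ => (integral_linkHess hB hchan hwave hf e i j).1),
    integral_finsetSum _ fun e _ => (integral_linkHess hB hchan hwave hf e i j).1]
  congr 1
  · rw [← hmp.map_eq, integral_map hmp.measurable.aemeasurable]
    rw [hmp.map_eq]
    exact hpi.aestronglyMeasurable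
  · exact Finset.sum_congr rfl fun e _ => (integral_linkHess hB hchan hwave hf e i j).2

end Network

namespace Network

variable {Na Nb : ℕ} {N : Network Na Nb} {Ω : Type*} [MeasurableSpace Ω] {μ : Measure Ω}
  {B : N.links → ℝ≥0 → Ω → ℝ} {Pbar : Positions Na} {f : Positions Na → ℝ}

/-! ### The equivalent Fisher information as a function of finitely many expectations -/

/-- Index set of the entries of `Φ(d, d) q qᵀ`, `q Φ(d, κ)` and `Φ(κ, κ)` for one link. -/
abbrev RelIdx (N : Network Na Nb) (e : N.links) : Type :=
  (Fin 2 × Fin 2) ⊕ (Fin 2 × N.Coord e) ⊕ (N.Coord e × N.Coord e)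

/-- The position block of the information of the waveforms and channel priors. -/
def posBlock (g : ∀ e : N.links, N.RelIdx e → ℝ) : Matrix (PosIdx Na) (PosIdx Na) ℝ :=
  Matrix.of fun x y => ∑ e : N.links,
    incidence e.1 x.1 * incidence e.1 y.1 * g e (.inl (x.2, y.2))

/-- The block of positions against multipath parameters. -/
def crossBlock (g : ∀ e : N.links, N.RelIdx e → ℝ) : Matrix (PosIdx Na) N.ChanIdx ℝ :=
  Matrix.of fun x i => incidence i.1.1 x.1 * g i.1 (.inr (.inl (x.2, i.2)))

/-- The block of the multipath parameters. -/
def chanBlock (g : ∀ e : N.links, N.RelIdx e → ℝ) : Matrix N.ChanIdx N.ChanIdx ℝ :=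
  Matrix.blockDiagonal' fun e : N.links => Matrix.of fun i j => g e (.inr (.inr (i, j)))

/-- The Schur complement as a function of the entries. -/
def schur (g : ∀ e : N.links, N.RelIdx e → ℝ) : Matrix (PosIdx Na) (PosIdx Na) ℝ :=
  posBlock g - crossBlock g * (chanBlock g)⁻¹ * (crossBlock g).transpose

theorem linkCoord_self (e : N.links) (i : N.Coord e) : linkCoord e (.inr ⟨e, i⟩) = .inr i := by
  simp [linkCoord]

/-- The waveforms and channel priors enter only through the averaged relevant functions. The
position prior touches the position block alone, so it passes unchanged through the Schur
complement. -/
theorem efim_eq_schur [IsProbabilityMeasure μ] (hB : N.IsNoise B μ)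
    (hchan : ∀ e : N.links, N.IsChannelPrior e)
    (hwave : N.WaveInfoExists B μ) (hf : N.IsPositionPrior B μ Pbar f) :
    N.efim B μ f =
      schur (fun e k => ∫ P, N.relevantFun B μ e k P ∂(posLaw f)) + posInfo f := by
  have h11 : (N.fim B μ f).toBlocks₁₁ =
      posBlock (fun e k => ∫ P, N.relevantFun B μ e k P ∂(posLaw f)) + posInfo f := by
    ext x y
    rw [Matrix.toBlocks₁₁, Matrix.of_apply, fim_apply hB hchan hwave hf, Matrix.add_apply, add_comm]
    congr 1
    rw [posBlock, Matrix.of_apply]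
    refine Finset.sum_congr rfl fun e _ => ?_
    rw [← integral_const_mul]
    refine integral_congr_ae (Filter.Eventually.of_forall fun P => ?_)
    simp only [linkRate, linkCoord, relevantFun]
    ring
  have h12 : (N.fim B μ f).toBlocks₁₂ =
      crossBlock (fun e k => ∫ P, N.relevantFun B μ e k P ∂(posLaw f)) := by
    ext x ⟨e, i⟩
    rw [Matrix.toBlocks₁₂, Matrix.of_apply, fim_apply hB hchan hwave hf,
      -- A channel parameter moves only its own link, so all other summands have rate zero.
      Finset.sum_eq_single_of_mem e (Finset.mem_univ e)]
    · rw [crossBlock, Matrix.of_apply, ← integral_const_mul]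
      simp only [posHess, neg_zero, integral_zero, zero_add]
      refine integral_congr_ae (Filter.Eventually.of_forall fun P => ?_)
      simp only [linkRate, linkCoord_self, relevantFun, if_true]
      simp only [linkCoord]
      ring
    · intro e' _ he
      simp [linkRate, he.symm]
  have h22 : (N.fim B μ f).toBlocks₂₂ =
      chanBlock (fun e k => ∫ P, N.relevantFun B μ e k P ∂(posLaw f)) := by
    ext ⟨e, i⟩ ⟨e', j⟩
    rw [Matrix.toBlocks₂₂, Matrix.of_apply, fim_apply hB hchan hwave hf,
      Finset.sum_eq_single_of_mem e (Finset.mem_univ e)]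
    · simp only [posHess, neg_zero, integral_zero, zero_add, chanBlock]
      by_cases he : e = e'
      · subst he
        rw [Matrix.blockDiagonal'_apply_eq, Matrix.of_apply]
        refine integral_congr_ae (Filter.Eventually.of_forall fun P => ?_)
        simp only [linkRate, linkCoord_self, relevantFun, if_true, one_mul]
      · rw [Matrix.blockDiagonal'_apply_ne _ _ _ he]
        simp [linkRate, Ne.symm he]
    · intro e' _ he
      simp [linkRate, he.symm]
  rw [efim]
  rw [h11, h12, h22, schur]
  abel

theorem continuous_entry (e : N.links) (k : N.RelIdx e) :
    Continuous fun g : ∀ e : N.links, N.RelIdx e → ℝ => g e k :=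
  (continuous_apply k).comp (continuous_apply e)

/-- Inversion is continuous at invertible matrices; the remaining operations are polynomial in the
entries. -/
theorem continuousAt_schurComplement {X m n : Type*} [TopologicalSpace X] [Fintype n]
    [DecidableEq n] {A : X → Matrix m m ℝ} {M : X → Matrix m n ℝ} {C : X → Matrix n n ℝ}
    (hA : Continuous A) (hM : Continuous M) (hC : Continuous C) {x : X}
    (h : IsUnit (C x).det) :
    ContinuousAt (fun y => A y - M y * (C y)⁻¹ * (M y).transpose) x := by
  have hinv : ContinuousAt (fun y => (C y)⁻¹) x := by
    refine ContinuousAt.comp (g := Inv.inv) (continuousAt_matrix_inv _ ?_) hC.continuousAt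
    obtain ⟨u, hu⟩ := h
    rw [← hu]
    exact NormedRing.inverse_continuousAt u
  have hmul : Continuous fun p : (Matrix m n ℝ × Matrix n n ℝ) × Matrix n m ℝ =>
      p.1.1 * p.1.2 * p.2 :=
    ((continuous_fst.comp continuous_fst).matrix_mul (continuous_snd.comp continuous_fst)).matrix_mul
      continuous_snd
  exact hA.continuousAt.sub (ContinuousAt.comp
    (f := fun y => ((M y, (C y)⁻¹), (M y).transpose)) hmul.continuousAt
    ((hM.continuousAt.prodMk hinv).prodMk hM.matrix_transpose.continuousAt))

theorem continuousAt_schur {g : ∀ e : N.links, N.RelIdx e → ℝ}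
    (h : IsUnit (chanBlock g).det) : ContinuousAt schur g := by
  have hA : Continuous fun g : ∀ e : N.links, N.RelIdx e → ℝ => posBlock g :=
    continuous_matrix fun x y => continuous_finsetSum _ fun e _ =>
      continuous_const.mul (continuous_entry e _)
  have hB : Continuous fun g : ∀ e : N.links, N.RelIdx e → ℝ => crossBlock g :=
    continuous_matrix fun x i => continuous_const.mul (continuous_entry i.1 _)
  have hC : Continuous fun g : ∀ e : N.links, N.RelIdx e → ℝ => chanBlock g :=
    Continuous.matrix_blockDiagonal' (continuous_pi fun e =>
      continuous_matrix fun i j => continuous_entry e _)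
  exact continuousAt_schurComplement hA hB hC h

/-! ### The Schur complement at given positions -/

section Point

variable [IsProbabilityMeasure μ] (hB : N.IsNoise B μ)
  (hchan : ∀ e : N.links, N.IsChannelPrior e) (hwave : N.WaveInfoExists B μ)
include hB hchan hwave

theorem linkInfo_nuisance (e : N.links) {d : ℝ} (hd : 0 < d) :
    (N.linkInfo B μ e d).toBlocks₂₂ = (1 / N.c ^ 2) • N.nuisanceInfo B μ e d := by
  ext i j
  have hc := N.c_pos.ne'
  rw [Matrix.toBlocks₂₂, Matrix.of_apply, (linkInfo_eq hB hwave e (hchan e) hd _ _).2.2]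
  simp only [waveDir, nuisanceInfo, Matrix.smul_apply, Matrix.add_apply, Matrix.submatrix_apply,
    Matrix.toBlocks₂₂, Matrix.of_apply, smul_eq_mul, Pi.single_apply, ite_div, zero_div, ite_mul,
    zero_mul, mul_ite, mul_zero, Finset.sum_ite_eq', Finset.mem_univ, if_true]
  field_simp

theorem linkInfo_cross (e : N.links) {d : ℝ} (hd : 0 < d) (i : N.Coord e) :
    N.linkInfo B μ e d (.inl ()) (.inr i) = 1 / N.c ^ 2 * N.crossInfo B μ e d i := by
  have hc := N.c_pos.ne'
  rw [(linkInfo_eq hB hwave e (hchan e) hd _ _).2.2]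
  simp only [waveDir, crossInfo, Matrix.vecMul, dotProduct, Pi.single_apply, ite_div, zero_div,
    ite_mul, zero_mul, mul_ite, mul_zero, Finset.sum_ite_eq', Finset.mem_univ, if_true]
  rw [mul_add, Finset.mul_sum]
  congr 1
  · exact Finset.sum_congr rfl fun j _ => by field_simp
  · field_simp

theorem linkInfo_dist (e : N.links) {d : ℝ} (hd : 0 < d) :
    N.linkInfo B μ e d (.inl ()) (.inl ()) = 1 / N.c ^ 2 *
      (dotProduct (lVec (N.L e)) (Matrix.mulVec (N.waveInfo B μ e d) (lVec (N.L e))) +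
        N.c ^ 2 * N.chanInfo e d (.inl ()) (.inl ())) := by
  have hc := N.c_pos.ne'
  rw [(linkInfo_eq hB hwave e (hchan e) hd _ _).2.2]
  simp only [waveDir, dotProduct, Matrix.mulVec]
  rw [mul_add, Finset.mul_sum]
  congr 1
  · refine Finset.sum_congr rfl fun i _ => ?_
    rw [Finset.mul_sum, Finset.mul_sum]
    exact Finset.sum_congr rfl fun j _ => by field_simp
  · field_simp

/-- Each block of `Φ` is `1 / c²` times its counterpart in delay coordinates. In `b K⁻¹ bᵀ` the two
factors from `b` and the inverse factor from `K` leave a single `1 / c²`, which is the prefactor of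
the RII. -/
theorem linkRii_eq (e : N.links) {d : ℝ} (hd : 0 < d)
    (hinv : IsUnit (N.nuisanceInfo B μ e d).det) :
    IsUnit (N.linkInfo B μ e d).toBlocks₂₂.det ∧
    N.linkRii B μ e d = N.linkInfo B μ e d (.inl ()) (.inl ()) -
      dotProduct (fun i => N.linkInfo B μ e d (.inl ()) (.inr i))
        (Matrix.mulVec ((N.linkInfo B μ e d).toBlocks₂₂)⁻¹
          fun i => N.linkInfo B μ e d (.inl ()) (.inr i)) := by
  have hc : N.c ^ 2 ≠ 0 := pow_ne_zero 2 N.c_pos.ne'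
  have hcross : (fun i => N.linkInfo B μ e d (.inl ()) (.inr i)) =
      (1 / N.c ^ 2) • N.crossInfo B μ e d := by
    funext i
    rw [linkInfo_cross hB hchan hwave e hd, Pi.smul_apply, smul_eq_mul]
  have hK := linkInfo_nuisance hB hchan hwave e hd
  have hKinv : ((1 / N.c ^ 2) • N.nuisanceInfo B μ e d)⁻¹ =
      N.c ^ 2 • (N.nuisanceInfo B μ e d)⁻¹ := by
    refine Matrix.inv_eq_right_inv ?_
    rw [Matrix.smul_mul, Matrix.mul_smul, Matrix.mul_nonsing_inv _ hinv, smul_smul,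
      one_div_mul_cancel hc, one_smul]
  refine ⟨?_, ?_⟩
  · rw [hK, Matrix.det_smul]
    exact ((isUnit_iff_ne_zero.2 (one_div_ne_zero hc)).pow _).mul hinv
  · rw [hK, hKinv, hcross, linkInfo_dist hB hchan hwave e hd, linkRii, Matrix.mulVec_smul,
      Matrix.smul_mulVec, smul_dotProduct, dotProduct_smul, dotProduct_smul]
    simp only [smul_eq_mul]
    field_simp

/-- The inverse of a block-diagonal matrix is taken blockwise, so links do not mix. Within a link
the cross block is `q` times a row vector; `q qᵀ` factors out and leaves the scalar Schur
complement. -/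
theorem schur_relevantFun {P : Positions Na} (hP : ∀ e : N.links, 0 < N.linkDist e P)
    (hinv : ∀ e : N.links, IsUnit (N.nuisanceInfo B μ e (N.linkDist e P)).det) :
    IsUnit (chanBlock (fun e k => N.relevantFun B μ e k P)).det ∧
    ∀ x y, schur (fun e k => N.relevantFun B μ e k P) x y = ∑ e : N.links,
      incidence e.1 x.1 * incidence e.1 y.1 *
        (N.linkRii B μ e (N.linkDist e P) * rdm (N.linkAngle e P) x.2 y.2) := by
  set K : ∀ e : N.links, Matrix (N.Coord e) (N.Coord e) ℝ :=
    fun e => (N.linkInfo B μ e (N.linkDist e P)).toBlocks₂₂ with hK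
  have hr := fun e : N.links => linkRii_eq hB hchan hwave e (hP e) (hinv e)
  have hmul : Matrix.blockDiagonal' K * Matrix.blockDiagonal' (fun e => (K e)⁻¹) = 1 := by
    rw [← Matrix.blockDiagonal'_mul, ← Matrix.blockDiagonal'_one]
    congr 1
    funext e
    exact Matrix.mul_nonsing_inv _ (hr e).1
  have hC : chanBlock (fun e k => N.relevantFun B μ e k P) = Matrix.blockDiagonal' K := rfl
  refine ⟨?_, fun x y => ?_⟩
  · rw [hC]
    exact (Matrix.isUnit_iff_isUnit_det _).1 (IsUnit.of_mul_eq_one _ hmul)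
  · rw [schur, hC, Matrix.inv_eq_right_inv hmul, Matrix.sub_apply, posBlock, Matrix.of_apply,
      Matrix.mul_assoc, Matrix.mul_apply, Fintype.sum_sigma, ← Finset.sum_sub_distrib]
    refine Finset.sum_congr rfl fun e _ => ?_
    have h1 : ∀ i : N.Coord e, (Matrix.blockDiagonal' (fun e => (K e)⁻¹) *
        (crossBlock (fun e k => N.relevantFun B μ e k P)).transpose) ⟨e, i⟩ y =
        incidence e.1 y.1 * unitVec (N.linkAngle e P) y.2 * Matrix.mulVec (K e)⁻¹
          (fun i => N.linkInfo B μ e (N.linkDist e P) (.inl ()) (.inr i)) i := by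
      intro i
      rw [Matrix.mul_apply, Fintype.sum_sigma, Finset.sum_eq_single_of_mem e (Finset.mem_univ e)]
      · rw [Matrix.mulVec, dotProduct, Finset.mul_sum]
        refine Finset.sum_congr rfl fun j _ => ?_
        rw [Matrix.blockDiagonal'_apply_eq, Matrix.transpose_apply, crossBlock, Matrix.of_apply]
        simp only [relevantFun]
        ring
      · intro e' _ he
        refine Finset.sum_eq_zero fun j _ => ?_
        rw [Matrix.blockDiagonal'_apply_ne _ _ _ he.symm, zero_mul]
    simp only [h1]
    simp only [(hr e).2, rdm_apply, dotProduct, crossBlock, Matrix.of_apply, relevantFun]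
    rw [sub_mul, mul_sub, Finset.sum_mul, Finset.mul_sum]
    congr 1
    exact Finset.sum_congr rfl fun i _ => by ring

end Point

/-! ### Assembling the links into the block matrix -/

/-- A weighted Laplacian: the signs of a link form a vector with `1` at the receiver and `-1` at a
transmitting agent, and its outer products are summed. The diagonal collects every link at an agent,
the off-diagonal both directions of a pair; anchors have no column of their own. -/
theorem sum_incidence {R : Fin Na → Fin Na → ℝ} (hR : ∀ k, R k k = 0) (h : Fin Na → Fin Nb → ℝ)
    (m n : Fin Na) :
    ∑ e : Fin Na × Node Na Nb, incidence e m * incidence e n *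
      Sum.elim (R e.1) (h e.1) e.2 =
    if m = n then ∑ b, h m b + ∑ j ∈ Finset.univ.erase m, (R m j + R j m)
    else -(R m n + R n m) := by
  -- For a fixed receiver the product of two signs expands into four terms for agents, and into one
  -- for anchors.
  have hs : ∀ k, ∑ j : Node Na Nb, incidence (k, j) m * incidence (k, j) n * Sum.elim (R k) (h k) j =
      (if k = m then if k = n then ∑ i, R k i else 0 else 0) - (if k = m then R k n else 0) -
      (if k = n then R k m else 0) + (if m = n then R k m else 0) +
      (if k = m then if k = n then ∑ b, h k b else 0 else 0) := by
    intro k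
    rw [Fintype.sum_sum_type]
    congr 1
    · simp only [incidence, Sum.elim_inl, Sum.inl.injEq, sub_mul, mul_sub, Finset.sum_sub_distrib,
        ite_mul, mul_ite, one_mul, zero_mul, mul_one, mul_zero, Finset.sum_ite_irrel,
        Finset.sum_const_zero, Finset.sum_ite_eq', Finset.mem_univ, if_true]
      by_cases h1 : k = m <;> by_cases h2 : k = n <;> by_cases h3 : m = n <;>
        simp_all
      all_goals exact fun h => absurd h.symm h3
    · by_cases h1 : k = m <;> by_cases h2 : k = n <;> simp [incidence, h1, h2]
  rw [Fintype.sum_prod_type]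
  simp only [hs, Finset.sum_add_distrib, Finset.sum_sub_distrib, Finset.sum_ite_eq',
    Finset.mem_univ, if_true]
  by_cases hmn : m = n
  · subst hmn
    have h1 : ∑ i, R m i = ∑ i ∈ Finset.univ.erase m, R m i := by
      rw [← Finset.add_sum_erase _ _ (Finset.mem_univ m), hR, zero_add]
    have h2 : ∑ i, R i m = ∑ i ∈ Finset.univ.erase m, R i m := by
      rw [← Finset.add_sum_erase _ _ (Finset.mem_univ m), hR, zero_add]
    simp only [if_true, hR, h1, h2]
    ring
  · simp only [hmn, if_false, Finset.sum_const_zero]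
    ring

theorem structuredInfo_apply (P : Positions Na) (x y : PosIdx Na) :
    N.structuredInfo B μ P x y = ∑ e : N.links,
      incidence e.1 x.1 * incidence e.1 y.1 *
        (N.linkRii B μ e (N.linkDist e P) * rdm (N.linkAngle e P) x.2 y.2) := by
  set R : Fin Na → Fin Na → ℝ := fun k j =>
    N.rii B μ P k (.inl j) * rdm (N.linkAngle (k, .inl j) P) x.2 y.2 with hRdef
  set h : Fin Na → Fin Nb → ℝ := fun k b =>
    N.rii B μ P k (.inr b) * rdm (N.linkAngle (k, .inr b) P) x.2 y.2 with hh
  have hR : ∀ k, R k k = 0 := fun k => by simp [hRdef, rii, N.no_self k]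
  have hsum : ∑ e : N.links, incidence e.1 x.1 * incidence e.1 y.1 *
        (N.linkRii B μ e (N.linkDist e P) * rdm (N.linkAngle e P) x.2 y.2) =
      ∑ e : Fin Na × Node Na Nb, incidence e x.1 * incidence e y.1 *
        Sum.elim (R e.1) (h e.1) e.2 := by
    have hG : ∀ e : Fin Na × Node Na Nb, Sum.elim (R e.1) (h e.1) e.2 =
        N.rii B μ P e.1 e.2 * rdm (N.linkAngle e P) x.2 y.2 := by
      rintro ⟨k, j | b⟩ <;> rfl
    simp only [hG]
    -- The sum over links extends to all pairs because the RII is zero off the links.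
    rw [← Finset.sum_subset (Finset.subset_univ N.links), ← Finset.sum_coe_sort N.links]
    · refine Finset.sum_congr rfl fun e _ => ?_
      have he : ((e : Fin Na × Node Na Nb).1, (e : Fin Na × Node Na Nb).2) ∈ N.links := e.2
      rw [rii, dif_pos he]
    · intro e _ he
      have he' : (e.1, e.2) ∉ N.links := he
      rw [rii, dif_neg he']
      simp
  rw [hsum, sum_incidence hR, structuredInfo, Matrix.of_apply]
  have hcoop : ∀ k j, N.coopInfo B μ P k j x.2 y.2 = R k j + R j k := by
    intro k j
    have hsymm : rdm (N.linkAngle (j, .inl k) P) = rdm (N.linkAngle (k, .inl j) P) :=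
      rdm_angle_comm _ _
    simp only [coopInfo, Matrix.smul_apply, smul_eq_mul, hRdef, hsymm]
    ring
  split_ifs with hxy
  · rw [Matrix.add_apply, anchorInfo, Matrix.sum_apply, Matrix.sum_apply]
    congr 1
    exact Finset.sum_congr rfl fun j _ => hcoop _ _
  · rw [hcoop]

theorem coopInfo_comm (P : Positions Na) (k j : Fin Na) :
    N.coopInfo B μ P k j = N.coopInfo B μ P j k := by
  have hsymm : rdm (N.linkAngle (j, .inl k) P) = rdm (N.linkAngle (k, .inl j) P) :=
    rdm_angle_comm _ _
  rw [coopInfo, coopInfo, hsymm, add_comm]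

end Network

theorem d2_comm {E : Type*} [NormedAddCommGroup E] [NormedSpace ℝ E] {f : E → ℝ} {x : E}
    (hf : ContDiffAt ℝ 2 f x) (v w : E) : d2 f x v w = d2 f x w v := by
  rw [d2_eq hf, d2_eq hf]
  exact (hf.isSymmSndFDerivAt (by simp)) v w

namespace Network

variable {Na Nb : ℕ} {N : Network Na Nb} {Ω : Type*} [MeasurableSpace Ω] {μ : Measure Ω}
  {B : N.links → ℝ≥0 → Ω → ℝ}

/-! ### Nonnegativity of the ranging information intensity -/

/-- By `d2_log_comp`, minus the second derivative of the logarithm is the squared score minus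
`F''/F`, and the latter has mean zero by second-order regularity. -/
theorem chanInfo_quadratic_nonneg {e : Fin Na × Node Na Nb} (h : N.IsChannelPrior e) {d : ℝ}
    (hd : 0 < d) (hreg : N.SecondOrderRegular e d) (w : Unit ⊕ N.Coord e → ℝ) :
    0 ≤ ∑ p, ∑ q, w p * w q * N.chanInfo e d p q := by
  set W := ∑ p, w p • N.linkDir e p with hW
  set F : ℝ × (N.Coord e → ℝ) → ℝ := fun y => N.chan e y.2 y.1 with hF
  have hS : MeasurableSet {κ | 0 < N.chan e κ d} :=
    measurableSet_lt measurable_const (h.measurable_left d)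
  have hterm : ∀ p q, Integrable
      (fun κ => w p * w q * (hess (N.linkDir e) F (d, κ) p q / F (d, κ))) (N.chanLaw e d) ∧
      ∫ κ, w p * w q * (hess (N.linkDir e) F (d, κ) p q / F (d, κ)) ∂(N.chanLaw e d) = 0 := by
    intro p q
    have hind : (fun κ => N.chan e κ d * (hess (N.linkDir e) F (d, κ) p q / F (d, κ))) =
        Set.indicator {κ | 0 < N.chan e κ d} fun κ => hess (N.linkDir e) F (d, κ) p q := by
      funext κ
      by_cases hκ : 0 < N.chan e κ d
      · rw [Set.indicator_of_mem (by exact hκ), mul_div_cancel₀]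
        exact hκ.ne'
      · have h0 : N.chan e κ d = 0 := le_antisymm (not_lt.1 hκ) (h.nonneg κ d)
        rw [Set.indicator_of_notMem (by exact hκ), h0, zero_mul]
    have h1 : Integrable (fun κ => hess (N.linkDir e) F (d, κ) p q / F (d, κ)) (N.chanLaw e d) := by
      rw [h.integrable_chanLaw_iff, hind, integrable_indicator_iff hS]
      exact (hreg p q).1
    refine ⟨h1.const_mul _, ?_⟩
    rw [integral_const_mul, h.integral_chanLaw, hind, integral_indicator hS, (hreg p q).2, mul_zero]
  have hlog : ∀ p q, Integrable
      (fun κ => w p * w q * -hess (N.linkDir e) (N.logChan e) (d, κ) p q) (N.chanLaw e d) :=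
    fun p q => (h.integrable d hd p q).neg.const_mul _
  have hterm' : ∀ p q, Integrable (fun κ => w p * w q * -hess (N.linkDir e) (N.logChan e) (d, κ) p q
      + w p * w q * (hess (N.linkDir e) F (d, κ) p q / F (d, κ))) (N.chanLaw e d) :=
    fun p q => (hlog p q).add (hterm p q).1
  -- Terms of mean zero are added under the integral, so that the integrand becomes a square almost
  -- everywhere.
  have heq : ∑ p, ∑ q, w p * w q * N.chanInfo e d p q = ∫ κ, ∑ p, ∑ q,
      (w p * w q * -hess (N.linkDir e) (N.logChan e) (d, κ) p q +
        w p * w q * (hess (N.linkDir e) F (d, κ) p q / F (d, κ))) ∂(N.chanLaw e d) := by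
    rw [integral_finsetSum _ fun p _ => integrable_finsetSum _ fun q _ => hterm' p q]
    refine Finset.sum_congr rfl fun p _ => ?_
    rw [integral_finsetSum _ fun q _ => hterm' p q]
    refine Finset.sum_congr rfl fun q _ => ?_
    rw [integral_add (hlog p q) (hterm p q).1, (hterm p q).2, add_zero, integral_const_mul]
    rfl
  rw [heq]
  refine integral_nonneg_of_ae ?_
  filter_upwards [h.ae_pos d] with κ hκ
  have hFc : ContDiffAt ℝ 2 F (d, κ) := h.contDiffAt hd hκ
  have h1 : ∑ p, ∑ q, w p * w q * hess (N.linkDir e) (N.logChan e) (d, κ) p q =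
      d2 (N.logChan e) (d, κ) W W := (d2_sum_sum (h.contDiffAt_log hd hκ) w w _).symm
  have h2 : ∑ p, ∑ q, w p * w q * hess (N.linkDir e) F (d, κ) p q = d2 F (d, κ) W W :=
    (d2_sum_sum hFc w w _).symm
  have h3 : d2 (N.logChan e) (d, κ) W W = _ := d2_log_comp hFc (by exact hκ.ne') W W
  have h4 : ∑ p, ∑ q, (w p * w q * -hess (N.linkDir e) (N.logChan e) (d, κ) p q +
      w p * w q * (hess (N.linkDir e) F (d, κ) p q / F (d, κ))) =
      (fderiv ℝ F (d, κ) W / F (d, κ)) ^ 2 := by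
    simp only [Finset.sum_add_distrib, mul_neg, Finset.sum_neg_distrib, ← mul_div_assoc,
      ← Finset.sum_div, h1, h2, h3]
    ring
  rw [h4]
  exact sq_nonneg _

theorem chanInfo_comm {e : Fin Na × Node Na Nb} (h : N.IsChannelPrior e) {d : ℝ}
    (hd : 0 < d) (p q : Unit ⊕ N.Coord e) : N.chanInfo e d p q = N.chanInfo e d q p := by
  rw [chanInfo, Matrix.of_apply, Matrix.of_apply]
  refine integral_congr_ae ?_
  filter_upwards [h.ae_pos d] with κ hκ
  exact congrArg Neg.neg (d2_comm (h.contDiffAt_log hd hκ) _ _)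

variable [IsProbabilityMeasure μ]

/-- For each fixed `κ` the average over the noise is `2 / N₀` times the energy of the signal's
derivative along the given direction. -/
theorem waveInfo_quadratic_nonneg (hB : N.IsNoise B μ) (hwave : N.WaveInfoExists B μ) (e : N.links) {d : ℝ}
    (hd : 0 < d) (h : N.IsChannelPrior e) (w : Fin (N.L e) ⊕ Fin (N.L e) → ℝ) :
    0 ≤ ∑ i, ∑ j, w i * w j * N.waveInfo B μ e d i j := by
  have := h.prob d hd
  have hint : ∀ i j, Integrable (fun z : (N.Coord e → ℝ) × Ω => w i * w j *
      -hess (fun i => Pi.single i (1 : ℝ))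
        (fun x => Real.log (lik N.c N.N₀ N.T N.s (N.linkObs e (d, z.1) (B e · z.2)) x))
        (delayAmp N.c d z.1) i j) ((N.chanLaw e d).prod μ) :=
    fun i j => (hwave e d hd i j).neg.const_mul _
  have hint' := integrable_finsetSum Finset.univ fun i _ =>
    integrable_finsetSum Finset.univ fun j _ => hint i j
  have heq : ∑ i, ∑ j, w i * w j * N.waveInfo B μ e d i j =
      ∫ z : (N.Coord e → ℝ) × Ω, ∑ i, ∑ j, w i * w j * -hess (fun i => Pi.single i (1 : ℝ))
        (fun x => Real.log (lik N.c N.N₀ N.T N.s (N.linkObs e (d, z.1) (B e · z.2)) x))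
        (delayAmp N.c d z.1) i j ∂((N.chanLaw e d).prod μ) := by
    rw [integral_finsetSum _ fun i _ => integrable_finsetSum _ fun j _ => hint i j]
    refine Finset.sum_congr rfl fun i _ => ?_
    rw [integral_finsetSum _ fun j _ => hint i j]
    refine Finset.sum_congr rfl fun j _ => ?_
    rw [integral_const_mul]
    rfl
  rw [heq, integral_prod _ hint']
  refine integral_nonneg fun κ => ?_
  set W : Fin (N.L e) ⊕ Fin (N.L e) → ℝ := ∑ i, w i • Pi.single i (1 : ℝ) with hW
  have hω : ∀ᵐ ω ∂μ, ∑ i, ∑ j, w i * w j * -hess (fun i => Pi.single i (1 : ℝ))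
        (fun x => Real.log (lik N.c N.N₀ N.T N.s (N.linkObs e (d, κ) (B e · ω)) x))
        (delayAmp N.c d κ) i j = -d2 (fun x => Real.log (lik N.c N.N₀ N.T N.s
        (observed N.c N.N₀ N.s (delayAmp N.c d κ) (B e · ω)) x)) (delayAmp N.c d κ) W W := by
    filter_upwards [hB.ae_continuous] with ω hω
    have hc : ContDiff ℝ 2 (fun x : Fin (N.L e) ⊕ Fin (N.L e) → ℝ => Real.log (lik N.c N.N₀ N.T N.s
        (observed N.c N.N₀ N.s (delayAmp N.c d κ) (B e · ω)) x)) := by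
      rw [log_lik_observed]
      exact contDiff_logLik (contDiff_rxSignal N.c N.s_smooth)
        (continuous_toNNReal_path (hω e)) _
    rw [hW, d2_sum_sum hc.contDiffAt]
    simp only [mul_neg, Finset.sum_neg_distrib]
    rfl
  show 0 ≤ ∫ ω, _ ∂μ
  rw [integral_congr_ae hω, hB.integral_hess]
  refine mul_nonneg (div_nonneg (by norm_num) N.N₀_pos.le)
    (intervalIntegral.integral_nonneg N.T_pos.le fun t _ => mul_self_nonneg _)

theorem waveInfo_comm (hB : N.IsNoise B μ) (e : N.links) (d : ℝ)
    (i j : Fin (N.L e) ⊕ Fin (N.L e)) : N.waveInfo B μ e d i j = N.waveInfo B μ e d j i := by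
  rw [waveInfo, Matrix.of_apply, Matrix.of_apply]
  refine integral_congr_ae ?_
  filter_upwards [hB.ae_continuous_prod] with z hz
  have hc : ContDiff ℝ 2 (fun x : Fin (N.L e) ⊕ Fin (N.L e) → ℝ => Real.log (lik N.c N.N₀ N.T N.s
      (observed N.c N.N₀ N.s (delayAmp N.c d z.1) (B e · z.2)) x)) := by
    rw [log_lik_observed]
    exact contDiff_logLik (contDiff_rxSignal N.c N.s_smooth)
      (continuous_toNNReal_path (hz e)) _
  exact congrArg Neg.neg (d2_comm hc.contDiffAt _ _)

theorem linkRii_nonneg (hB : N.IsNoise B μ) (hchan : ∀ e : N.links, N.IsChannelPrior e)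
    (hwave : N.WaveInfoExists B μ) (e : N.links) {d : ℝ} (hd : 0 < d)
    (hinv : IsUnit (N.nuisanceInfo B μ e d).det) (hreg : N.SecondOrderRegular e d) :
    0 ≤ N.linkRii B μ e d := by
  have hΦ := fun p q => (linkInfo_eq hB hwave e (hchan e) hd p q).2.2
  have hsymm : ∀ p q, N.linkInfo B μ e d p q = N.linkInfo B μ e d q p := by
    intro p q
    rw [hΦ, hΦ, chanInfo_comm (hchan e) hd, Finset.sum_comm]
    congr 1
    refine Finset.sum_congr rfl fun i _ => Finset.sum_congr rfl fun j _ => ?_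
    rw [waveInfo_comm hB]
    ring
  have hquad : ∀ w : Unit ⊕ N.Coord e → ℝ, 0 ≤ ∑ p, ∑ q, w p * w q * N.linkInfo B μ e d p q := by
    intro w
    have h1 := waveInfo_quadratic_nonneg hB hwave e hd (hchan e)
      -- The direction `w` in `(d, κ)` is pushed forward to delays and scaled amplitudes, which
      -- reduces the waveform part to the form already known to be nonnegative.
      fun i => ∑ p, w p * (N.waveDir e p i / N.c)
    have h2 := chanInfo_quadratic_nonneg (hchan e) hd hreg w
    have h3 : ∑ p, ∑ q, w p * w q * N.linkInfo B μ e d p q =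
        (∑ i, ∑ j, (∑ p, w p * (N.waveDir e p i / N.c)) * (∑ q, w q * (N.waveDir e q j / N.c)) *
          N.waveInfo B μ e d i j) + ∑ p, ∑ q, w p * w q * N.chanInfo e d p q := by
      simp only [hΦ, mul_add, Finset.sum_add_distrib]
      congr 1
      simp only [Finset.sum_mul, Finset.mul_sum]
      calc _ = ∑ p, ∑ i, ∑ q, ∑ j, w p * w q * (N.waveDir e p i / N.c * (N.waveDir e q j / N.c) *
            N.waveInfo B μ e d i j) :=
            Finset.sum_congr rfl fun p _ => Finset.sum_comm
        _ = ∑ i, ∑ p, ∑ j, ∑ q, w p * w q * (N.waveDir e p i / N.c * (N.waveDir e q j / N.c) *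
            N.waveInfo B μ e d i j) := by
            rw [Finset.sum_comm]
            exact Finset.sum_congr rfl fun i _ => Finset.sum_congr rfl fun p _ => Finset.sum_comm
        _ = _ := by
            refine Finset.sum_congr rfl fun i _ => ?_
            rw [Finset.sum_comm]
            refine Finset.sum_congr rfl fun j _ => ?_
            rw [Finset.sum_comm]
            exact Finset.sum_congr rfl fun q _ => Finset.sum_congr rfl fun p _ => by ring
    rw [h3]
    exact add_nonneg h1 h2
  obtain ⟨hu, hr⟩ := linkRii_eq hB hchan hwave e hd hinv
  set b : N.Coord e → ℝ := fun i => N.linkInfo B μ e d (.inl ()) (.inr i) with hb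
  set K := (N.linkInfo B μ e d).toBlocks₂₂ with hK
  set t : N.Coord e → ℝ := Matrix.mulVec K⁻¹ b with ht
  have hKt : Matrix.mulVec K t = b := by
    rw [ht, Matrix.mulVec_mulVec, Matrix.mul_nonsing_inv _ hu, Matrix.one_mulVec]
  -- The minimizer of the quadratic form with distance coordinate `1` is `(1, -K⁻¹ b)`, and its
  -- value is the Schur complement.
  have h := hquad (Sum.elim (fun _ => 1) fun i => -t i)
  have hval : ∑ p, ∑ q, (Sum.elim (fun _ => (1 : ℝ)) (fun i => -t i) : Unit ⊕ N.Coord e → ℝ) p *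
      (Sum.elim (fun _ => (1 : ℝ)) (fun i => -t i) : Unit ⊕ N.Coord e → ℝ) q *
      N.linkInfo B μ e d p q =
      N.linkInfo B μ e d (.inl ()) (.inl ()) - 2 * dotProduct b t +
        dotProduct t (Matrix.mulVec K t) := by
    have hbs : ∀ i, N.linkInfo B μ e d (.inr i) (.inl ()) = b i := fun i => hsymm _ _
    have hbl : ∀ i, N.linkInfo B μ e d (.inl ()) (.inr i) = b i := fun i => rfl
    have hKl : ∀ i j, N.linkInfo B μ e d (.inr i) (.inr j) = K i j := fun i j => rfl
    have h1 : ∑ i, ∑ j, t i * t j * K i j = dotProduct t (Matrix.mulVec K t) := by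
      simp only [dotProduct, Matrix.mulVec, Finset.mul_sum]
      exact Finset.sum_congr rfl fun i _ => Finset.sum_congr rfl fun j _ => by ring
    have h2 : ∑ i, t i * b i = dotProduct b t :=
      Finset.sum_congr rfl fun i _ => mul_comm _ _
    simp only [Fintype.sum_sum_type, Finset.univ_unique, Finset.sum_singleton, Sum.elim_inl,
      Sum.elim_inr, PUnit.default_eq_unit, hbs, hbl, hKl, Finset.sum_add_distrib, one_mul,
      mul_one, neg_mul, mul_neg, Finset.sum_neg_distrib, h1, h2]
    ring
  rw [hval, hKt, dotProduct_comm t b] at h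
  rw [hr]
  linarith

end Network

end CoopLoc

end
-- The corollary
open CoopLoc in
theorem corollary1 {Na Nb : ℕ} (N : Network Na Nb)
    {Ω : Type*} [MeasurableSpace Ω] (μ : MeasureTheory.Measure Ω)
    [MeasureTheory.IsProbabilityMeasure μ]
    (B : N.links → ℝ≥0 → Ω → ℝ) (hB : N.IsNoise B μ)
    (hchan : ∀ e : N.links, N.IsChannelPrior e)
    (hwave : N.WaveInfoExists B μ)
    (Pbar : Positions Na)
    (hdist : ∀ e : N.links, 0 < N.linkDist e Pbar)
    (hinv : ∀ e : N.links, IsUnit (N.nuisanceInfo B μ e (N.linkDist e Pbar)).det) :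
    (∀ f : Positions Na → ℝ, N.IsPositionPrior B μ Pbar f →
      (∀ (e : N.links) i, ∫ P, N.relevantFun B μ e i P ∂(Network.posLaw f) =
        N.relevantFun B μ e i Pbar) →
      N.efim B μ f = N.structuredInfo B μ Pbar + Network.posInfo f) ∧
    (∀ ε > 0, ∃ δ > 0, ∀ f : Positions Na → ℝ, N.IsPositionPrior B μ Pbar f →
      (∀ (e : N.links) i, |∫ P, N.relevantFun B μ e i P ∂(Network.posLaw f) -
        N.relevantFun B μ e i Pbar| ≤ δ) →
      ∀ x y, |N.efim B μ f x y - (N.structuredInfo B μ Pbar + Network.posInfo f) x y| ≤ ε) ∧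
    (∀ k j, N.coopInfo B μ Pbar k j = N.coopInfo B μ Pbar j k) ∧
    (∀ e : N.links, N.SecondOrderRegular e (N.linkDist e Pbar) →
      0 ≤ N.linkRii B μ e (N.linkDist e Pbar)) := by
  obtain ⟨hdet, hval⟩ := Network.schur_relevantFun hB hchan hwave hdist hinv
  have hS : Network.schur (fun e k => N.relevantFun B μ e k Pbar) = N.structuredInfo B μ Pbar := by
    ext x y
    rw [hval, Network.structuredInfo_apply]
  refine ⟨fun f hf hg => ?_, fun ε hε => ?_, Network.coopInfo_comm Pbar, fun e hreg =>
    Network.linkRii_nonneg hB hchan hwave e (hdist e) (hinv e) hreg⟩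
  · rw [Network.efim_eq_schur hB hchan hwave hf, ← hS]
    simp only [hg]
  -- Continuity at the fixed point `g(Pbar)` is used before any prior is chosen, so `δ` is uniform
  -- over the priors.
  · have hcont := Network.continuousAt_schur hdet
    have hentry : ∀ x y, ∀ᶠ g in nhds (fun (e : N.links) (k : N.RelIdx e) =>
        N.relevantFun B μ e k Pbar), |Network.schur g x y - N.structuredInfo B μ Pbar x y| < ε := by
      intro x y
      have h1 : ContinuousAt (fun g : ∀ e : N.links, N.RelIdx e → ℝ => Network.schur g x y)
          fun e k => N.relevantFun B μ e k Pbar :=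
        ((continuous_id.matrix_elem x y).continuousAt (x := Network.schur _)).comp hcont
      have h2 := Metric.continuousAt_iff'.1 h1 ε hε
      simpa only [hS, Real.dist_eq] using h2
    have hall := Filter.eventually_all.2 fun x => Filter.eventually_all.2 (hentry x)
    obtain ⟨δ, hδ, hball⟩ := Metric.eventually_nhds_iff.1 hall
    -- The hypothesis is a weak inequality while the neighbourhood is an open ball in the sup
    -- metric, hence the half.
    refine ⟨δ / 2, half_pos hδ, fun f hf hg x y => ?_⟩
    have hclose := hball (y := fun e k => ∫ P, N.relevantFun B μ e k P ∂(Network.posLaw f))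
      (lt_of_le_of_lt ((dist_pi_le_iff (half_pos hδ).le).2 fun e =>
        (dist_pi_le_iff (half_pos hδ).le).2 fun k => hg e k) (half_lt_self hδ)) x y
    -- The a priori information, which depends on the prior, cancels in the difference.
    rw [Network.efim_eq_schur hB hchan hwave hf, Matrix.add_apply, Matrix.add_apply,
      add_sub_add_right_eq_sub]
    exact hclose.le
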